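/- Let $(p_k)_{k\in\mathbb N}$ be a probability distribution with $p_k>0$ for infinitely many $k$, and put $\rho(t)=\#\{k\in\mathbb N:\ p_k>0,\ 1/p_k\le t\}$ for $t>0$. Balls $1,2,\dots$ are thrown independently into boxes $1,2,\dots$, each ball hitting box $k$ with probability $p_k$. For $j,n\in\mathbb N=\{1,2,\dots\}$ let $\mathcal K^*_j(n)$ be the number of boxes that contain exactly $j$ of the first $n$ balls (deterministic scheme). In the Poissonized scheme the $i$-th ball is thrown at time $S_i$, where $(S_i)_{i\ge1}$ is a random walk whose jumps are independent and exponentially distributed with unit mean, and which is independent of the allocation of the balls to the boxes; $K^*_j(t)$ is the number of boxes that contain exactly $j$ balls at time $t\ge 0$ in this scheme. The two schemes need not be defined on a common probability space. A function $L$ that is positive and measurable on a neighbourhood of $\infty$ is slowly varying if $L(\lambda t)/L(t)\to1$ as $t\to\infty$ for every $\lambda>0$. Assume that one of the following holds: (i) $\rho\in\Pi_{\ell,\infty}$, that is, there is a slowly varying function $\ell$ with $\lim_{t\to\infty}\ell(t)=\infty$ such that $\lim_{t\to\infty}\dfrac{\rho(\lambda t)-\rho(t)}{\ell(t)}=\log\lambda$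 for all $\lambda>0$; (ii) $\rho$ is regularly varying at $\infty$ of some index $\alpha\in(0,1]$, that is, $\rho(t)\sim t^\alpha L(t)$ as $t\to\infty$ for some slowly varying function $L$. Then, for every $j\in\mathbb N$, $$\lim_{n\to\infty}\frac{\operatorname{Var}\mathcal K^*_j(n)}{\operatorname{Var}K^*_j(n)}=1 .$$ -/

import Mathlib

open Filter Topology MeasureTheory ProbabilityTheory Asymptotics

noncomputable section

namespace Karlin

/-- `L` is slowly varying at `∞`: it is positive and measurable on some half-line `[T, ∞)`, and
`L (lam * t) / L t → 1` as `t → ∞`, for every `lam > 0`. -/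
def SlowlyVarying (L : ℝ → ℝ) : Prop :=
  (∃ T : ℝ, (∀ t, T ≤ t → 0 < L t) ∧ Measurable ((Set.Ici T).domRestrict L)) ∧
    ∀ lam : ℝ, 0 < lam → Tendsto (fun t : ℝ => L (lam * t) / L t) atTop (𝓝 1)

/-- `f` is regularly varying at `∞` of index `α`: `f t ∼ t ^ α * L t` as `t → ∞` for some `L`
slowly varying at `∞`. -/
def RegularlyVarying (α : ℝ) (f : ℝ → ℝ) : Prop :=
  ∃ L : ℝ → ℝ, SlowlyVarying L ∧ f ~[atTop] fun t : ℝ => t ^ α * L t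

/-- `f` belongs to the de Haan class `Π` with the auxiliary function `ell`: `ell` is slowly varying
at `∞` and `(f (lam * t) - f t) / ell t → log lam` as `t → ∞`, for every `lam > 0`. -/
def DeHaan (ell f : ℝ → ℝ) : Prop :=
  SlowlyVarying ell ∧
    ∀ lam : ℝ, 0 < lam →
      Tendsto (fun t : ℝ => (f (lam * t) - f t) / ell t) atTop (𝓝 (Real.log lam))

/-- `f` belongs to the class `Π_{ℓ,∞}`: it is in the de Haan class `Π` with an auxiliary function
that tends to `∞`. -/
def DeHaanInfty (f : ℝ → ℝ) : Prop :=
  ∃ ell : ℝ → ℝ, DeHaan ell f ∧ Tendsto ell atTop atTop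

/-- `ρ(t) = #{k : 1 / p_k ≤ t}`. Boxes with `p_k = 0` (for which `1 / p_k = ∞`) are not counted.
The set is finite since the `p_k` sum to `1`. The boxes are labelled by `0, 1, 2, …`. -/
def rho (p : PMF ℕ) (t : ℝ) : ℝ :=
  ({k : ℕ | 0 < (p k).toReal ∧ 1 / (p k).toReal ≤ t}.ncard : ℝ)

/-- The number of boxes that contain exactly `j` balls, when `B` is the set of the balls thrown so
far and `x i` is the box hit by the ball `i`. The balls are labelled by `0, 1, 2, …`. -/
def numExactly (j : ℕ) (B : Set ℕ) (x : ℕ → ℕ) : ℕ :=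
  {k : ℕ | {i : ℕ | i ∈ B ∧ x i = k}.encard = (j : ℕ∞)}.ncard

/-- `X 0, X 1, …` are the boxes hit by the successive balls: independent random variables with
distribution `p`. -/
structure IsAllocation {Ω : Type*} [MeasurableSpace Ω] (p : PMF ℕ) (P : Measure Ω)
    (X : ℕ → Ω → ℕ) : Prop where
  measurable : ∀ i, Measurable (X i)
  law : ∀ i, P.map (X i) = p.toMeasure
  indep : iIndepFun X P

/-- `E 0, E 1, …` are independent random variables with the exponential distribution of unit
mean: the jumps of the random walk of throwing times. -/
structure IsExpSequence {Ω : Type*} [MeasurableSpace Ω] (P : Measure Ω)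
    (E : ℕ → Ω → ℝ) : Prop where
  measurable : ∀ i, Measurable (E i)
  law : ∀ i, P.map (E i) = expMeasure 1
  indep : iIndepFun E P

/-- The data of the Poissonized scheme: the boxes `X` hit by the successive balls, and the jumps
`E` of the random walk of throwing times; the two sequences are independent of each other. -/
structure IsPoissonizedScheme {Ω : Type*} [MeasurableSpace Ω] (p : PMF ℕ) (P : Measure Ω)
    (X : ℕ → Ω → ℕ) (E : ℕ → Ω → ℝ) : Prop where
  allocation : IsAllocation p P X
  jumps : IsExpSequence P E
  indep : IndepFun (fun ω i => X i ω) (fun ω i => E i ω) P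

/-- The time at which the ball `i` (the `(i+1)`-st ball) is thrown in the Poissonized scheme: the
position of the random walk with jumps `E` after `i + 1` steps. -/
def throwTime {Ω : Type*} (E : ℕ → Ω → ℝ) (i : ℕ) (ω : Ω) : ℝ :=
  ∑ m ∈ Finset.range (i + 1), E m ω

/-- The small count `𝒦*_j(n)` of the deterministic scheme: the number of boxes hit by exactly `j`
of the first `n` balls. -/
def detCount {Ω : Type*} (X : ℕ → Ω → ℕ) (j n : ℕ) (ω : Ω) : ℝ :=
  (numExactly j {i : ℕ | i < n} (fun i => X i ω) : ℝ)

/-- The small count `K*_j(t)` of the Poissonized scheme: the number of boxes that contain exactly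
`j` of the balls thrown in the time interval `[0, t]`. -/
def poissonCount {Ω : Type*} (X : ℕ → Ω → ℕ) (E : ℕ → Ω → ℝ) (j : ℕ) (t : ℝ) (ω : Ω) : ℝ :=
  (numExactly j {i : ℕ | throwTime E i ω ≤ t} (fun i => X i ω) : ℝ)

end Karlin

end

noncomputable section

namespace Karlin

/-! Either variance is a double sum, over pairs of boxes, of covariances of occupancy indicators
(`variance_ncard_eq_tsum`). After Poissonization the boxes are independent, so only the diagonal
terms q_k - q_k² survive, with q_k = `poissonWeight j (p_k * t)`. In the deterministic scheme the
probabilities are binomial and trinomial. Uniformly in the boxes, passing to the Poisson values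
costs at most (C/n) u_k on the diagonal, and an off-diagonal covariance is at most (C/n) u_k u_l in
absolute value, where u_k = `majorant j (p_k * n)`. With F = `momentSum`, the sum of the u_k is 2^j
F(n/2), so the variances differ by at most a constant times (F(n/2)² + F(n/2)) / n
(`exists_abs_variance_sub_le`).

The Poissonized variance is at least F(n) / (3 j!), because q_k ≤ 2/3. The relative error is
therefore at most a constant times (F(n/2) / F(n)) * (F(n/2) + 1) / n. The last factor tends to 0
for every distribution, by dominated convergence (`tendsto_momentSum_div`). There remains F(t/2) =
O(F(t)), and this is where the regularity of ρ enters.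

The shell of boxes with 1/2 ≤ p_k t < 1 has ρ(2t) - ρ(t) elements and bounds F(t) from below. Boxes
with p_k t < 1 contribute to F(t/2) at most e times what they contribute to F(t); those with p_k t ≥
1 contribute at most a multiple of `tailSum`, which has to be bounded by the shell. For a positive
index of regular variation the shell is at least a fixed multiple of ρ(t), the number of all these
boxes. In the de Haan case the shell has about ℓ(t) log 2 elements, so consecutive dyadic shells are
comparable, and the weights (p_k t)⁻² make their contributions decay geometrically. -/

/-! ### Comparison of multinomial and Poisson weights -/

/-- The probability that a Poisson variable with mean `x` equals `j`. -/
def poissonWeight (j : ℕ) (x : ℝ) : ℝ := Real.exp (-x) * x ^ j / (j.factorial : ℝ)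

/-- The probability that a binomial variable with parameters `n`, `a` equals `j`. -/
def binomialWeight (j n : ℕ) (a : ℝ) : ℝ := (n.choose j : ℝ) * a ^ j * (1 - a) ^ (n - j)

/-- The probability that two given cells of a multinomial variable both contain `j` of `n`
balls. -/
def trinomialWeight (j n : ℕ) (a b : ℝ) : ℝ :=
  (n.choose j : ℝ) * ((n - j).choose j : ℝ) * a ^ j * b ^ j * (1 - a - b) ^ (n - 2 * j)

/-- The majorant `x ^ j * exp (-x / 2)` of the weights. -/
def majorant (j : ℕ) (x : ℝ) : ℝ := x ^ j * Real.exp (-(x / 2))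

lemma poissonWeight_nonneg (j : ℕ) {x : ℝ} (hx : 0 ≤ x) : 0 ≤ poissonWeight j x := by
  unfold poissonWeight; positivity

lemma majorant_nonneg (j : ℕ) {x : ℝ} (hx : 0 ≤ x) : 0 ≤ majorant j x := by
  unfold majorant; positivity

/-- In the exponential series a neighbour of the term of index j is at least half as large: the
preceding one if x ≤ j, the following one if x ≥ j. The two together are at most exp x. A bound
below 1 keeps q - q² comparable to q; it fails for j = 0 at x = 0. -/
lemma poissonWeight_le_two_thirds {j : ℕ} (hj : 1 ≤ j) {x : ℝ} (hx : 0 ≤ x) :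
    poissonWeight j x ≤ 2 / 3 := by
  obtain ⟨i, rfl⟩ : ∃ i, j = i + 1 := ⟨j - 1, by omega⟩
  have hsum := Real.sum_le_exp_of_nonneg hx (i + 3)
  rw [Finset.sum_range_succ, Finset.sum_range_succ, Finset.sum_range_succ] at hsum
  have h0 : 0 ≤ ∑ m ∈ Finset.range i, x ^ m / (m.factorial : ℝ) :=
    Finset.sum_nonneg fun m _ => by positivity
  have hf : (0 : ℝ) < i.factorial := by positivity
  set y : ℝ := x ^ i / (i.factorial : ℝ) with hy
  have hy0 : 0 ≤ y := by positivity
  have h1 : x ^ (i + 1) / ((i + 1).factorial : ℝ) = y * x / (i + 1) := by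
    rw [hy, Nat.factorial_succ]; push_cast; field_simp; ring
  have h2 : x ^ (i + 2) / ((i + 2).factorial : ℝ) = y * x / (i + 1) * (x / (i + 2)) := by
    rw [hy, Nat.factorial_succ, Nat.factorial_succ]; push_cast; field_simp; ring
  have key : 3 / 2 * (y * x / (i + 1)) ≤ Real.exp x := by
    rw [h1, h2] at hsum
    rcases le_total x (i + 1) with h | h
    · have : y * x / (i + 1) ≤ y := by
        rw [div_le_iff₀ (by positivity)]
        exact mul_le_mul_of_nonneg_left h hy0
      have : 0 ≤ y * x / (i + 1) * (x / (i + 2)) := by positivity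
      linarith
    · have h3 : 1 / 2 ≤ x / (i + 2) := by
        rw [div_le_div_iff₀ (by norm_num) (by positivity)]
        have : (0 : ℝ) ≤ i := by positivity
        linarith
      have : 0 ≤ y * x / (i + 1) := by positivity
      nlinarith
  unfold poissonWeight
  rw [mul_div_assoc, h1, Real.exp_neg, inv_mul_eq_div, div_le_iff₀ (Real.exp_pos x)]
  linarith

lemma pow_sub_pow_le_mul {a b : ℝ} (hb : 0 ≤ b) (hab : b ≤ a) (m : ℕ) :
    a ^ m - b ^ m ≤ m * (a - b) * a ^ (m - 1) := by
  have h := abs_pow_sub_pow_le a b m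
  rw [abs_of_nonneg (hb.trans hab), abs_of_nonneg hb, max_eq_left hab,
    abs_of_nonneg (sub_nonneg.2 hab)] at h
  calc a ^ m - b ^ m ≤ _ := (le_abs_self _).trans h
    _ = _ := by ring

lemma one_sub_le_descFactorial_div (m : ℕ) {n : ℕ} (hn : 0 < n) (hmn : m ≤ n) :
    1 - (m : ℝ) ^ 2 / n ≤ (n.descFactorial m : ℝ) / (n : ℝ) ^ m := by
  have hn' : (0 : ℝ) < n := by exact_mod_cast hn
  have h1 : ((n : ℝ) - m) ^ m ≤ n.descFactorial m := by
    have h := Nat.pow_sub_le_descFactorial n m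
    have h2 : (((n - m : ℕ) : ℝ)) ^ m ≤ n.descFactorial m := by
      exact_mod_cast (Nat.pow_le_pow_left (by omega) m).trans h
    rwa [Nat.cast_sub hmn] at h2
  have h3 : (1 : ℝ) + m * (-(m / n)) ≤ (1 + -(m / n)) ^ m := by
    apply one_add_mul_le_pow
    have : (m : ℝ) / n ≤ 1 := by
      rw [div_le_one hn']; exact_mod_cast hmn
    linarith
  rw [le_div_iff₀ (by positivity)]
  calc (1 - (m : ℝ) ^ 2 / n) * (n : ℝ) ^ m = (1 + m * (-(m / n))) * (n : ℝ) ^ m := by ring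
    _ ≤ (1 + -(m / n)) ^ m * (n : ℝ) ^ m := by gcongr
    _ = ((n : ℝ) - m) ^ m := by rw [← mul_pow]; congr 1; field_simp; ring
    _ ≤ _ := h1

lemma descFactorial_div_le_one (m n : ℕ) :
    (n.descFactorial m : ℝ) / (n : ℝ) ^ m ≤ 1 := by
  apply div_le_one_of_le₀ _ (by positivity)
  exact_mod_cast Nat.descFactorial_le_pow n m

/-- As s ≤ 1, each of the c missing factors exp (-s) costs at most a factor e. Exponents such as n -
j may thus be replaced by n, uniformly in s. -/
lemma one_sub_pow_le_exp {s : ℝ} (hs0 : 0 ≤ s) (hs1 : s ≤ 1) {n m c : ℕ} (h : n ≤ m + c) :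
    Real.exp (-s) ^ m ≤ Real.exp c * Real.exp (-(s * n)) := by
  rw [← Real.exp_nat_mul, ← Real.exp_add]
  apply Real.exp_le_exp.2
  have h' : (n : ℝ) ≤ m + c := by exact_mod_cast h
  nlinarith [mul_le_mul_of_nonneg_left h' hs0, mul_nonneg (sub_nonneg.2 hs1) (Nat.cast_nonneg (α := ℝ) c)]

/-- Half of the exponential decay is spent on absorbing the polynomial factor; hence the x / 2 in
`majorant`. -/
lemma one_add_mul_exp_le {x : ℝ} : (1 + x) * Real.exp (-x) ≤ 2 * Real.exp (-(x / 2)) := by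
  have h : 1 + x ≤ 2 * Real.exp (x / 2) := by
    have := Real.add_one_le_exp (x / 2)
    linarith
  calc (1 + x) * Real.exp (-x) ≤ 2 * Real.exp (x / 2) * Real.exp (-x) := by gcongr
    _ = _ := by rw [mul_assoc, ← Real.exp_add]; ring_nf

/-- Compare both powers with A ^ (n - 2 * j), A = (1 - a) * (1 - b). Changing the base costs a
multiple of n a b, since A - (1 - a - b) = a b; changing the exponent costs a multiple of j (a + b),
by Bernoulli. In terms of a n and b n, both are of order 1 / n. -/
lemma abs_one_sub_pow_sub_le (j : ℕ) {n : ℕ} (hn : 2 * j + 1 ≤ n) {a b : ℝ} (ha : 0 ≤ a)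
    (hb : 0 ≤ b) (hab : a + b ≤ 1) :
    |(1 - a - b) ^ (n - 2 * j) - ((1 - a) * (1 - b)) ^ (n - j)| ≤
      Real.exp (2 * j + 1 : ℕ) * (j + 1) / n * ((1 + a * n) * (1 + b * n) *
        Real.exp (-((a + b) * n))) := by
  have hn' : (0 : ℝ) < n := by exact_mod_cast (by omega : 0 < n)
  obtain ⟨m, rfl⟩ : ∃ m, n = m + 1 + 2 * j := ⟨n - (2 * j + 1), by omega⟩
  have e1 : m + 1 + 2 * j - 2 * j = m + 1 := by omega
  have e2 : m + 1 + 2 * j - j = m + 1 + j := by omega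
  rw [e1, e2]
  set n : ℕ := m + 1 + 2 * j with hndef
  set A : ℝ := (1 - a) * (1 - b) with hA
  have hA0 : 0 ≤ A := mul_nonneg (by linarith) (by linarith)
  have hA1 : A ≤ 1 := by
    have := mul_nonneg ha hb
    nlinarith
  have hAB : A - (1 - a - b) = a * b := by rw [hA]; ring
  have hAe : A ≤ Real.exp (-(a + b)) := by
    rw [neg_add, Real.exp_add]
    exact mul_le_mul (by linarith [Real.add_one_le_exp (-a)])
      (by linarith [Real.add_one_le_exp (-b)]) (by linarith) (Real.exp_pos _).le
  set K : ℝ := Real.exp (2 * j + 1 : ℕ) * Real.exp (-((a + b) * n)) with hK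
  have hK0 : 0 < K := by positivity
  have hAm : A ^ m ≤ K := (pow_le_pow_left₀ hA0 hAe m).trans
    (one_sub_pow_le_exp (by linarith) hab (by omega))
  have hAm1 : A ^ (m + 1) ≤ K := (pow_le_pow_of_le_one hA0 hA1 (by omega)).trans hAm
  have hab0 : 0 ≤ a * b := mul_nonneg ha hb
  have i1 : A ^ (m + 1) - (1 - a - b) ^ (m + 1) ≤ n * (a * b) * K := by
    have := pow_sub_pow_le_mul (a := A) (b := 1 - a - b) (by linarith) (by linarith) (m + 1)
    rw [hAB] at this
    refine this.trans ?_
    simp only [Nat.add_sub_cancel]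
    have : ((m + 1 : ℕ) : ℝ) ≤ n := by exact_mod_cast (by omega)
    gcongr
  have i2 : A ^ (m + 1) - A ^ (m + 1 + j) ≤ j * (a + b) * K := by
    have h : (1 : ℝ) + j * (A - 1) ≤ (1 + (A - 1)) ^ j := one_add_mul_le_pow (by linarith) j
    rw [add_sub_cancel] at h
    have h2 : 1 - A ^ j ≤ j * (a + b) := by
      have : (j : ℝ) * (1 - A) ≤ j * (a + b) := by gcongr; linarith
      linarith
    calc A ^ (m + 1) - A ^ (m + 1 + j) = (1 - A ^ j) * A ^ (m + 1) := by ring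
      _ ≤ j * (a + b) * K := by
        apply mul_le_mul h2 hAm1 (by positivity) (by positivity)
  have i3 : (1 - a - b) ^ (m + 1) ≤ A ^ (m + 1) := pow_le_pow_left₀ (by linarith) (by linarith) _
  have i4 : A ^ (m + 1 + j) ≤ A ^ (m + 1) := pow_le_pow_of_le_one hA0 hA1 (by omega)
  have hr : Real.exp (2 * j + 1 : ℕ) * (j + 1) / n * ((1 + a * n) * (1 + b * n) *
        Real.exp (-((a + b) * n))) = K * (j + 1) * ((1 / n + (a + b)) + n * (a * b)) := by
    rw [hK]; field_simp; ring
  rw [hr]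
  have j0 : (0 : ℝ) ≤ j := by positivity
  have k1 : 0 ≤ K * (j + 1) * (1 / n) := by positivity
  have k2 : 0 ≤ K * (a + b) := by positivity
  have k3 : 0 ≤ K * j * (n * (a * b)) := by positivity
  have k4 : 0 ≤ K * (n * (a * b)) := by positivity
  have k5 : 0 ≤ K * j * (a + b) := by positivity
  rw [abs_le]
  constructor <;> nlinarith

/-- The trinomial weight is close to the product of two binomial weights. -/
lemma exists_abs_trinomialWeight_sub_le (j : ℕ) : ∃ C : ℝ, 0 ≤ C ∧ ∀ n : ℕ, 2 * j + 1 ≤ n →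
    ∀ a b : ℝ, 0 ≤ a → 0 ≤ b → a + b ≤ 1 →
      |trinomialWeight j n a b - binomialWeight j n a * binomialWeight j n b| ≤
        C / n * (majorant j (a * n) * majorant j (b * n)) := by
  -- 4 j² = (2 j)² comes from the falling factorials, j + 1 from the powers, and the last 4 from
  -- applying `one_add_mul_exp_le` to both cells.
  refine ⟨Real.exp (2 * j + 1 : ℕ) * (4 * j ^ 2 + j + 1) * 4, by positivity, ?_⟩
  intro n hn a b ha hb hab
  have hn' : (0 : ℝ) < n := by exact_mod_cast (by omega : 0 < n)
  have hjf : (0 : ℝ) < j.factorial := by positivity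
  set f₁ : ℝ := (n.descFactorial (2 * j) : ℝ) / (n : ℝ) ^ (2 * j) with hf₁
  set f₂ : ℝ := (n.descFactorial j : ℝ) / (n : ℝ) ^ j with hf₂
  have a1 : f₁ ≤ 1 := descFactorial_div_le_one _ _
  have a2 : f₂ ≤ 1 := descFactorial_div_le_one _ _
  have a3 : 0 ≤ f₁ := by positivity
  have a4 : 0 ≤ f₂ := by positivity
  have a5 : 1 - 4 * (j : ℝ) ^ 2 / n ≤ f₁ := by
    have := one_sub_le_descFactorial_div (2 * j) (n := n) (by omega) (by omega)
    push_cast at this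
    rw [mul_pow] at this
    norm_num at this ⊢
    exact this
  have a6 : 1 - (j : ℝ) ^ 2 / n ≤ f₂ := one_sub_le_descFactorial_div j (n := n) (by omega) (by omega)
  have a7 : |f₁ - f₂ ^ 2| ≤ 4 * (j : ℝ) ^ 2 / n := by
    have e : 4 * (j : ℝ) ^ 2 / n = 4 * ((j : ℝ) ^ 2 / n) := by ring
    have e0 : 0 ≤ (j : ℝ) ^ 2 / n := by positivity
    have e1 : f₂ ^ 2 ≤ 1 := pow_le_one₀ a4 a2
    have e2 : 1 - 2 * ((j : ℝ) ^ 2 / n) ≤ f₂ ^ 2 := by nlinarith [sq_nonneg (1 - f₂)]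
    rw [e] at a5 ⊢
    rw [abs_le]; constructor <;> linarith
  set E₁ : ℝ := (1 - a - b) ^ (n - 2 * j) with hE₁
  set E₂ : ℝ := ((1 - a) * (1 - b)) ^ (n - j) with hE₂
  set G : ℝ := (1 + a * n) * (1 + b * n) * Real.exp (-((a + b) * n)) with hG
  have hE : |E₁ - E₂| ≤ Real.exp (2 * j + 1 : ℕ) * (j + 1) / n * G :=
    abs_one_sub_pow_sub_le j hn ha hb hab
  have hE₁0 : 0 ≤ E₁ := pow_nonneg (by linarith) _
  have hE₁1 : E₁ ≤ Real.exp (2 * j + 1 : ℕ) * G := by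
    have h1 : E₁ ≤ Real.exp (2 * j + 1 : ℕ) * Real.exp (-((a + b) * n)) := by
      refine (pow_le_pow_left₀ (by linarith) ?_ _).trans
        (one_sub_pow_le_exp (s := a + b) (m := n - 2 * j) (by linarith) hab (by omega))
      linarith [Real.add_one_le_exp (-(a + b))]
    refine h1.trans ?_
    have : 1 ≤ (1 + a * n) * (1 + b * n) := by
      have := mul_nonneg ha hn'.le
      have := mul_nonneg hb hn'.le
      nlinarith
    gcongr
    exact le_mul_of_one_le_left (Real.exp_pos _).le this
  have hG4 : G ≤ 4 * (Real.exp (-(a * n / 2)) * Real.exp (-(b * n / 2))) := by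
    have h1 := one_add_mul_exp_le (x := a * n)
    have h2 := one_add_mul_exp_le (x := b * n)
    have h3 : G = ((1 + a * n) * Real.exp (-(a * n))) * ((1 + b * n) * Real.exp (-(b * n))) := by
      rw [hG, show -((a + b) * n) = -(a * n) + -(b * n) by ring, Real.exp_add]; ring
    rw [h3]
    calc _ ≤ (2 * Real.exp (-(a * n / 2))) * (2 * Real.exp (-(b * n / 2))) := by gcongr
      _ = _ := by ring
  have hG0 : 0 ≤ G := by positivity
  have hmain : |f₁ * E₁ - f₂ ^ 2 * E₂| ≤
      Real.exp (2 * j + 1 : ℕ) * (4 * j ^ 2 + j + 1) / n * G := by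
    have e : f₁ * E₁ - f₂ ^ 2 * E₂ = (f₁ - f₂ ^ 2) * E₁ + f₂ ^ 2 * (E₁ - E₂) := by ring
    rw [e]
    refine (abs_add_le _ _).trans ?_
    rw [abs_mul, abs_mul, abs_of_nonneg hE₁0, abs_of_nonneg (sq_nonneg f₂)]
    calc _ ≤ 4 * (j : ℝ) ^ 2 / n * (Real.exp (2 * j + 1 : ℕ) * G) +
          1 * (Real.exp (2 * j + 1 : ℕ) * (j + 1) / n * G) := by
            gcongr
            exact pow_le_one₀ a4 a2
      _ = _ := by ring
  have c2 : (n.choose j : ℝ) = f₂ * (n : ℝ) ^ j / j.factorial := by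
    rw [Nat.choose_eq_descFactorial_div_factorial,
      Nat.cast_div (Nat.factorial_dvd_descFactorial n j) (by positivity), hf₂]
    field_simp
  have c1 : (n.choose j : ℝ) * ((n - j).choose j : ℝ) =
      f₁ * (n : ℝ) ^ (2 * j) / (j.factorial : ℝ) ^ 2 := by
    have : n.descFactorial (2 * j) = (n - j).descFactorial j * n.descFactorial j := by
      have h := Nat.descFactorial_mul_descFactorial (n := n) (k := j) (m := 2 * j) (by omega)
      rw [← h]; congr 2; omega
    rw [Nat.choose_eq_descFactorial_div_factorial, Nat.choose_eq_descFactorial_div_factorial,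
      Nat.cast_div (Nat.factorial_dvd_descFactorial n j) (by positivity),
      Nat.cast_div (Nat.factorial_dvd_descFactorial (n - j) j) (by positivity), hf₁, this]
    push_cast
    field_simp
  have hfac : trinomialWeight j n a b - binomialWeight j n a * binomialWeight j n b =
      (a * n) ^ j * (b * n) ^ j / (j.factorial : ℝ) ^ 2 * (f₁ * E₁ - f₂ ^ 2 * E₂) := by
    unfold trinomialWeight binomialWeight
    rw [c1, c2, hE₂, mul_pow (1 - a), mul_pow a, mul_pow b]
    ring
  rw [hfac, abs_mul, abs_of_nonneg (by positivity)]
  have hj1 : (1 : ℝ) ≤ (j.factorial : ℝ) ^ 2 :=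
    one_le_pow₀ (by exact_mod_cast Nat.one_le_iff_ne_zero.2 (Nat.factorial_ne_zero j))
  unfold majorant
  calc _ ≤ (a * n) ^ j * (b * n) ^ j / 1 * (Real.exp (2 * j + 1 : ℕ) * (4 * j ^ 2 + j + 1) / n *
        (4 * (Real.exp (-(a * n / 2)) * Real.exp (-(b * n / 2))))) := by
        gcongr
        exact hmain.trans (by gcongr)
    _ = _ := by ring

lemma abs_one_sub_pow_sub_exp_le (j : ℕ) {n : ℕ} (hn : 2 * j + 1 ≤ n) {a : ℝ} (ha : 0 ≤ a)
    (ha1 : a ≤ 1) :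
    |(1 - a) ^ (n - j) - Real.exp (-(a * n))| ≤
      Real.exp (2 * j + 1 : ℕ) * (j + 1) / n * ((1 + a * n) ^ 2 * Real.exp (-(a * n))) := by
  have hn' : (0 : ℝ) < n := by exact_mod_cast (by omega : 0 < n)
  set K : ℝ := Real.exp (2 * j + 1 : ℕ) * Real.exp (-(a * n)) with hK
  have hK0 : 0 < K := by positivity
  have hexp : 1 - a ≤ Real.exp (-a) := by linarith [Real.add_one_le_exp (-a)]
  have hexp2 : Real.exp (-a) - (1 - a) ≤ a ^ 2 := by
    have := Real.abs_exp_sub_one_sub_id_le (x := -a) (by rw [abs_neg, abs_of_nonneg ha]; exact ha1)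
    have := (le_abs_self _).trans this
    nlinarith
  have e0 : Real.exp (-a) ^ n = Real.exp (-(a * n)) := by
    rw [← Real.exp_nat_mul]; ring_nf
  have i1 : Real.exp (-(a * n)) - (1 - a) ^ n ≤ n * a ^ 2 * K := by
    have := pow_sub_pow_le_mul (a := Real.exp (-a)) (b := 1 - a) (by linarith) hexp n
    rw [e0] at this
    refine this.trans ?_
    have h2 := one_sub_pow_le_exp (s := a) ha ha1 (n := n) (m := n - 1) (c := 2 * j + 1) (by omega)
    have : 0 ≤ Real.exp (-a) - (1 - a) := by linarith
    gcongr
  have i2 : (1 - a) ^ (n - j) - (1 - a) ^ n ≤ j * a * K := by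
    have h : (1 : ℝ) + j * (-a) ≤ (1 + (-a)) ^ j := one_add_mul_le_pow (by linarith) j
    rw [← sub_eq_add_neg] at h
    have hp : (1 - a) ^ (n - j) ≤ K := (pow_le_pow_left₀ (by linarith) hexp _).trans
      (one_sub_pow_le_exp (s := a) ha ha1 (by omega))
    have h3 : (1 - a) ^ n = (1 - a) ^ (n - j) * (1 - a) ^ j := by
      rw [← pow_add]; congr 1; omega
    calc (1 - a) ^ (n - j) - (1 - a) ^ n = (1 - (1 - a) ^ j) * (1 - a) ^ (n - j) := by
          rw [h3]; ring
      _ ≤ j * a * K := by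
        apply mul_le_mul (by linarith) hp (pow_nonneg (by linarith) _) (by positivity)
  have i3 : (1 - a) ^ n ≤ (1 - a) ^ (n - j) :=
    pow_le_pow_of_le_one (by linarith) (by linarith) (by omega)
  have i4 : (1 - a) ^ n ≤ Real.exp (-(a * n)) := by
    rw [← e0]; exact pow_le_pow_left₀ (by linarith) hexp _
  have hr : Real.exp (2 * j + 1 : ℕ) * (j + 1) / n * ((1 + a * n) ^ 2 * Real.exp (-(a * n))) =
      K * (j + 1) * ((1 / n + 2 * a) + n * a ^ 2) := by
    rw [hK]; field_simp; ring
  rw [hr]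
  have k1 : 0 ≤ K * (j + 1) * (1 / n) := by positivity
  have k2 : 0 ≤ K * a := by positivity
  have k3 : 0 ≤ K * j * (n * a ^ 2) := by positivity
  have k4 : 0 ≤ K * (n * a ^ 2) := by positivity
  have k5 : 0 ≤ K * j * a := by positivity
  rw [abs_le]
  constructor <;> nlinarith

lemma one_add_sq_mul_exp_le {x : ℝ} (hx : 0 ≤ x) :
    (1 + x) ^ 2 * Real.exp (-x) ≤ 16 * Real.exp (-(x / 2)) := by
  have h : 1 + x ≤ 4 * Real.exp (x / 4) := by
    have := Real.add_one_le_exp (x / 4)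
    linarith
  calc (1 + x) ^ 2 * Real.exp (-x) ≤ (4 * Real.exp (x / 4)) ^ 2 * Real.exp (-x) := by gcongr
    _ = 16 * Real.exp (-(x / 2)) := by
      rw [mul_pow, ← Real.exp_nat_mul, mul_assoc, ← Real.exp_add]
      norm_num
      ring_nf

/-- The binomial weight is close to the Poisson weight. -/
lemma exists_abs_binomialWeight_sub_le (j : ℕ) : ∃ C : ℝ, 0 ≤ C ∧ ∀ n : ℕ, 2 * j + 1 ≤ n →
    ∀ a : ℝ, 0 ≤ a → a ≤ 1 →
      |binomialWeight j n a - poissonWeight j (a * n)| ≤ C / n * majorant j (a * n) := by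
  refine ⟨Real.exp (2 * j + 1 : ℕ) * (j ^ 2 + j + 1) * 16, by positivity, ?_⟩
  intro n hn a ha ha1
  have hn' : (0 : ℝ) < n := by exact_mod_cast (by omega : 0 < n)
  have hjf : (0 : ℝ) < j.factorial := by positivity
  set f : ℝ := (n.descFactorial j : ℝ) / (n : ℝ) ^ j with hf
  have a2 : f ≤ 1 := descFactorial_div_le_one _ _
  have a4 : 0 ≤ f := by positivity
  have a6 : 1 - (j : ℝ) ^ 2 / n ≤ f := one_sub_le_descFactorial_div j (n := n) (by omega) (by omega)
  have a7 : |f - 1| ≤ (j : ℝ) ^ 2 / n := by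
    have : 0 ≤ (j : ℝ) ^ 2 / n := by positivity
    rw [abs_le]; constructor <;> linarith
  set E : ℝ := (1 - a) ^ (n - j) with hE
  set G : ℝ := (1 + a * n) ^ 2 * Real.exp (-(a * n)) with hG
  have hE0 : 0 ≤ E := pow_nonneg (by linarith) _
  have hE1 : E ≤ Real.exp (2 * j + 1 : ℕ) * G := by
    have h1 : E ≤ Real.exp (2 * j + 1 : ℕ) * Real.exp (-(a * n)) := by
      refine (pow_le_pow_left₀ (by linarith) ?_ _).trans
        (one_sub_pow_le_exp (s := a) (m := n - j) ha ha1 (by omega))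
      linarith [Real.add_one_le_exp (-a)]
    refine h1.trans ?_
    have : 1 ≤ (1 + a * n) ^ 2 := one_le_pow₀ (by linarith [mul_nonneg ha hn'.le])
    gcongr
    exact le_mul_of_one_le_left (Real.exp_pos _).le this
  have hG0 : 0 ≤ G := by positivity
  have hmain : |f * E - Real.exp (-(a * n))| ≤
      Real.exp (2 * j + 1 : ℕ) * (j ^ 2 + j + 1) / n * G := by
    have e : f * E - Real.exp (-(a * n)) = (f - 1) * E + (E - Real.exp (-(a * n))) := by ring
    rw [e]
    refine (abs_add_le _ _).trans ?_
    rw [abs_mul, abs_of_nonneg hE0]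
    calc _ ≤ (j : ℝ) ^ 2 / n * (Real.exp (2 * j + 1 : ℕ) * G) +
          (Real.exp (2 * j + 1 : ℕ) * (j + 1) / n * G) := by
            gcongr
            exact abs_one_sub_pow_sub_exp_le j hn ha ha1
      _ = _ := by ring
  have c2 : (n.choose j : ℝ) = f * (n : ℝ) ^ j / j.factorial := by
    rw [Nat.choose_eq_descFactorial_div_factorial,
      Nat.cast_div (Nat.factorial_dvd_descFactorial n j) (by positivity), hf]
    field_simp
  have hfac : binomialWeight j n a - poissonWeight j (a * n) =
      (a * n) ^ j / (j.factorial : ℝ) * (f * E - Real.exp (-(a * n))) := by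
    unfold binomialWeight poissonWeight
    rw [c2, mul_pow a]
    ring
  rw [hfac, abs_mul, abs_of_nonneg (by positivity)]
  have hj1 : (1 : ℝ) ≤ (j.factorial : ℝ) := by
    exact_mod_cast Nat.one_le_iff_ne_zero.2 (Nat.factorial_ne_zero j)
  have := one_add_sq_mul_exp_le (x := a * n) (by positivity)
  unfold majorant
  calc _ ≤ (a * n) ^ j / 1 * (Real.exp (2 * j + 1 : ℕ) * (j ^ 2 + j + 1) / n *
        (16 * Real.exp (-(a * n / 2)))) := by
        gcongr
        exact hmain.trans (by gcongr)
    _ = _ := by ring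

/-! ### Sums over the boxes and the counting function -/

/-- The sum over the boxes of `x ^ j * exp (-x)` with `x = w k * t`. -/
def momentSum (w : ℕ → ℝ) (j : ℕ) (t : ℝ) : ℝ :=
  ∑' k, (w k * t) ^ j * Real.exp (-(w k * t))

/-- The boxes with `w k * t ≥ 1`. -/
def bigBoxes (w : ℕ → ℝ) (t : ℝ) : Set ℕ := {k | 1 ≤ w k * t}

lemma finite_bigBoxes {w : ℕ → ℝ} (hw : Summable w) (t : ℝ) : (bigBoxes w t).Finite := by
  have h := (hw.mul_right t).tendsto_cofinite_zero.eventually_lt_const (zero_lt_one' ℝ)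
  have h' := eventually_cofinite.1 h
  simpa [bigBoxes] using h'

lemma pow_mul_exp_neg_le_factorial (m : ℕ) {x : ℝ} (hx : 0 ≤ x) :
    x ^ m * Real.exp (-x) ≤ m.factorial := by
  have h := Real.pow_div_factorial_le_exp x hx m
  rw [div_le_iff₀ (by positivity)] at h
  calc x ^ m * Real.exp (-x) ≤ (Real.exp x * m.factorial) * Real.exp (-x) := by gcongr
    _ = m.factorial := by
      rw [mul_right_comm, ← Real.exp_add]; simp

lemma pow_mul_exp_neg_le_mul {j : ℕ} (hj : 1 ≤ j) {x : ℝ} (hx : 0 ≤ x) :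
    x ^ j * Real.exp (-x) ≤ (j - 1).factorial * x := by
  obtain ⟨i, rfl⟩ : ∃ i, j = i + 1 := ⟨j - 1, by omega⟩
  have := pow_mul_exp_neg_le_factorial i hx
  simp only [Nat.add_sub_cancel]
  calc x ^ (i + 1) * Real.exp (-x) = (x ^ i * Real.exp (-x)) * x := by ring
    _ ≤ _ := by gcongr

section Weights

variable {w : ℕ → ℝ} (hw0 : ∀ k, 0 ≤ w k) (hw : Summable w)

include hw0 hw

lemma summable_momentSum {j : ℕ} (hj : 1 ≤ j) {t : ℝ} (ht : 0 ≤ t) :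
    Summable fun k => (w k * t) ^ j * Real.exp (-(w k * t)) := by
  have hx : ∀ k, 0 ≤ w k * t := fun k => mul_nonneg (hw0 k) ht
  refine Summable.of_nonneg_of_le (fun k => ?_) (fun k => pow_mul_exp_neg_le_mul hj (hx k))
    ((hw.mul_right t).mul_left _)
  have := hx k
  positivity

/-- With x = w k * t, a term divided by t is w k * x ^ (j - 1) * exp (-x). This tends to 0 for each
k and is dominated by (j - 1)! * w k, which is summable. -/
lemma tendsto_momentSum_div {j : ℕ} (hj : 1 ≤ j) :
    Tendsto (fun t => momentSum w j t / t) atTop (𝓝 0) := by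
  have h : Tendsto (fun t : ℝ => ∑' k, (w k * t) ^ j * Real.exp (-(w k * t)) / t) atTop
      (𝓝 (∑' _ : ℕ, (0 : ℝ))) := by
    refine tendsto_tsum_of_dominated_convergence (bound := fun k => (j - 1).factorial * w k)
      (hw.mul_left _) (fun k => ?_) ?_
    · obtain ⟨i, rfl⟩ : ∃ i, j = i + 1 := ⟨j - 1, by omega⟩
      rcases (hw0 k).eq_or_lt with h0 | h0
      · simp [← h0]
      have h1 := (Real.tendsto_pow_mul_exp_neg_atTop_nhds_zero i).comp
        (tendsto_id.const_mul_atTop h0)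
      have h2 := h1.const_mul (w k)
      rw [mul_zero] at h2
      refine h2.congr' ?_
      filter_upwards [eventually_gt_atTop 0] with t ht
      simp only [Function.comp_apply, id]
      field_simp
      ring
    · filter_upwards [eventually_gt_atTop 0] with t ht k
      have hx : 0 ≤ w k * t := mul_nonneg (hw0 k) ht.le
      rw [Real.norm_of_nonneg (by positivity), div_le_iff₀ ht, mul_assoc]
      exact pow_mul_exp_neg_le_mul hj hx
  rw [tsum_zero] at h
  exact h.congr fun t => by rw [momentSum, tsum_div_const]

lemma momentSum_pos {j : ℕ} (hj : 1 ≤ j) {t : ℝ} (ht : 0 < t) {k : ℕ} (hk : 0 < w k) :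
    0 < momentSum w j t := by
  refine (summable_momentSum hw0 hw hj ht.le).tsum_pos (fun i => ?_) k (by positivity)
  have := mul_nonneg (hw0 i) ht.le
  positivity

omit hw in
lemma bigBoxes_subset_two_mul {t : ℝ} (ht : 0 ≤ t) : bigBoxes w t ⊆ bigBoxes w (2 * t) := by
  intro k hk
  have := mul_nonneg (hw0 k) ht
  simp only [bigBoxes, Set.mem_ofPred_eq] at hk ⊢
  linarith

omit hw in
lemma bigBoxes_mono {s t : ℝ} (h : s ≤ t) : bigBoxes w s ⊆ bigBoxes w t := by
  intro k hk
  have := mul_le_mul_of_nonneg_left h (hw0 k)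
  simp only [bigBoxes, Set.mem_ofPred_eq] at hk ⊢
  linarith

lemma ncard_shell {t : ℝ} (ht : 0 ≤ t) :
    ((bigBoxes w (2 * t) \ bigBoxes w t).ncard : ℝ) =
      (bigBoxes w (2 * t)).ncard - (bigBoxes w t).ncard := by
  rw [eq_sub_iff_add_eq]
  exact_mod_cast Set.ncard_sdiff_add_ncard_of_subset (bigBoxes_subset_two_mul hw0 ht)
    (finite_bigBoxes hw _)

/-- On the shell 1/2 ≤ w k * t < 1, so each of its boxes contributes at least (1/2) ^ j * exp (-1).
-/
lemma shell_le_momentSum {j : ℕ} (hj : 1 ≤ j) {t : ℝ} (ht : 0 ≤ t) :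
    ((1 / 2) ^ j * Real.exp (-1)) * (bigBoxes w (2 * t) \ bigBoxes w t).ncard ≤
      momentSum w j t := by
  have hfin : (bigBoxes w (2 * t) \ bigBoxes w t).Finite := (finite_bigBoxes hw _).sdiff
  rw [Set.ncard_eq_toFinset_card _ hfin, mul_comm, ← nsmul_eq_mul]
  have hx : ∀ k, 0 ≤ w k * t := fun k => mul_nonneg (hw0 k) ht
  refine (Finset.card_nsmul_le_sum _ _ _ fun k hk => ?_).trans
    ((summable_momentSum hw0 hw hj ht).sum_le_tsum hfin.toFinset fun k _ => ?_)
  · simp only [bigBoxes, Set.Finite.mem_toFinset, Set.mem_sdiff, Set.mem_ofPred_eq, not_le] at hk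
    have h1 : 1 / 2 ≤ w k * t := by linarith [hk.1]
    have h2 : w k * t ≤ 1 := hk.2.le
    gcongr
  · have := hx k
    positivity

/-- The sum of `x ^ (-2)` over the boxes with `x = w k * t ≥ 1`. -/
def tailSum (w : ℕ → ℝ) (t : ℝ) : ℝ :=
  ∑' k, (bigBoxes w t).indicator (fun k => ((w k * t) ^ 2)⁻¹) k

omit hw0 in
lemma summable_tailSum (t : ℝ) :
    Summable ((bigBoxes w t).indicator fun k => ((w k * t) ^ 2)⁻¹) :=
  summable_of_hasFiniteSupport ((finite_bigBoxes hw t).subset Set.support_indicator_subset)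

omit hw0 in
lemma tailSum_eq_sum (t : ℝ) :
    tailSum w t = ∑ k ∈ (finite_bigBoxes hw t).toFinset, ((w k * t) ^ 2)⁻¹ := by
  rw [tailSum, tsum_eq_sum (s := (finite_bigBoxes hw t).toFinset)]
  · refine Finset.sum_congr rfl fun k hk => Set.indicator_of_mem (by simpa using hk) _
  · intro k hk
    exact Set.indicator_of_notMem (by simpa using hk) _

omit hw0 in
lemma tailSum_le_ncard (t : ℝ) : tailSum w t ≤ (bigBoxes w t).ncard := by
  rw [tailSum_eq_sum hw, Set.ncard_eq_toFinset_card _ (finite_bigBoxes hw t), ← nsmul_one]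
  refine Finset.sum_le_card_nsmul _ _ _ fun k hk => ?_
  have : 1 ≤ w k * t := by simpa [bigBoxes] using hk
  exact inv_le_one_of_one_le₀ (one_le_pow₀ this)

/-- Doubling t divides the weights of the old boxes by 4, and the newly admitted boxes have weight
at most 1. The gain 1/4 outweighs the factor 2 allowed between consecutive shells in
`exists_tailSum_le_shell`. -/
lemma tailSum_two_mul_le {t : ℝ} (ht : 0 ≤ t) :
    tailSum w (2 * t) ≤ (bigBoxes w (2 * t) \ bigBoxes w t).ncard + tailSum w t / 4 := by
  have hsub := bigBoxes_subset_two_mul hw0 ht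
  have hfin : (bigBoxes w (2 * t) \ bigBoxes w t).Finite := (finite_bigBoxes hw _).sdiff
  have hsplit : (finite_bigBoxes hw (2 * t)).toFinset =
      hfin.toFinset ∪ (finite_bigBoxes hw t).toFinset := by
    ext k
    have := @hsub k
    simp only [Set.Finite.mem_toFinset, Finset.mem_union, Set.mem_sdiff]
    tauto
  have hdisj : Disjoint hfin.toFinset (finite_bigBoxes hw t).toFinset := by
    rw [Finset.disjoint_left]
    intro k hk hk'
    simp only [Set.Finite.mem_toFinset, Set.mem_sdiff] at hk hk'
    exact hk.2 hk'
  rw [tailSum_eq_sum hw, tailSum_eq_sum hw, hsplit, Finset.sum_union hdisj, Finset.sum_div]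
  refine add_le_add ?_ (le_of_eq (Finset.sum_congr rfl fun k _ => ?_))
  · rw [Set.ncard_eq_toFinset_card _ hfin, ← nsmul_one]
    refine Finset.sum_le_card_nsmul _ _ _ fun k hk => ?_
    simp only [bigBoxes, Set.Finite.mem_toFinset, Set.mem_sdiff, Set.mem_ofPred_eq] at hk
    exact inv_le_one_of_one_le₀ (one_le_pow₀ hk.1)
  · rw [show (w k * (2 * t)) ^ 2 = (w k * t) ^ 2 * 4 by ring, mul_inv]; rfl

/-- Put x = w k * t. For x < 1, halving the exponent costs at most a factor e. For x ≥ 1 the term is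
O(x⁻²), because y ^ (j + 2) * exp (-y) ≤ (j + 2)! at y = x / 2. -/
lemma momentSum_half_le {j : ℕ} (hj : 1 ≤ j) {t : ℝ} (ht : 0 ≤ t) :
    momentSum w j (t / 2) ≤
      Real.exp 1 * momentSum w j t + 4 * (j + 2).factorial * tailSum w t := by
  rw [momentSum, momentSum, tailSum, ← tsum_mul_left, ← tsum_mul_left]
  have s1 := (summable_momentSum hw0 hw hj ht).mul_left (Real.exp 1)
  have s2 := (summable_tailSum hw t).mul_left (4 * (j + 2).factorial : ℝ)
  rw [← s1.tsum_add s2]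
  refine (summable_momentSum hw0 hw hj (by positivity)).tsum_le_tsum (fun k => ?_) (s1.add s2)
  have hx : 0 ≤ w k * t := mul_nonneg (hw0 k) ht
  rw [← mul_div_assoc]
  by_cases hk : k ∈ bigBoxes w t
  · rw [Set.indicator_of_mem hk]
    have hk' : 1 ≤ w k * t := hk
    have h := pow_mul_exp_neg_le_factorial (j + 2) (x := w k * t / 2) (by positivity)
    have h2 : (w k * t / 2) ^ j * Real.exp (-(w k * t / 2)) ≤
        4 * (j + 2).factorial * ((w k * t) ^ 2)⁻¹ := by
      rw [← div_eq_mul_inv, le_div_iff₀ (by positivity)]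
      calc _ = 4 * ((w k * t / 2) ^ (j + 2) * Real.exp (-(w k * t / 2))) := by ring
        _ ≤ _ := by gcongr
    refine h2.trans (le_add_of_nonneg_left (by positivity))
  · rw [Set.indicator_of_notMem hk, mul_zero, add_zero]
    have hk' : w k * t < 1 := not_le.1 hk
    calc (w k * t / 2) ^ j * Real.exp (-(w k * t / 2))
        ≤ (w k * t) ^ j * Real.exp (1 + -(w k * t)) := by
          gcongr <;> linarith
      _ = _ := by rw [Real.exp_add]; ring

/-- If the number of boxes in a dyadic shell eventually at most doubles when going one shell up
towards large boxes, and is bounded below, it controls the sum over all big boxes. -/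
lemma exists_tailSum_le_shell {T : ℝ} (hT : 0 < T)
    (h1 : ∀ t, T ≤ t → (1 : ℝ) ≤ (bigBoxes w (2 * t) \ bigBoxes w t).ncard)
    (h2 : ∀ t, T ≤ t → ((bigBoxes w (2 * t) \ bigBoxes w t).ncard : ℝ) ≤
      2 * (bigBoxes w (2 * (2 * t)) \ bigBoxes w (2 * t)).ncard) :
    ∃ K : ℝ, 0 ≤ K ∧ ∀ t, T ≤ t →
      tailSum w t ≤ K * (bigBoxes w (2 * t) \ bigBoxes w t).ncard := by
  -- The second entry serves the base range [T, 2 T]. The 4 closes the induction: the bound at 2 s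
  -- is (1 + K / 4) times the shell at s, hence at most (2 + K / 2) times the shell at 2 s, and 2 +
  -- K / 2 ≤ K.
  set K : ℝ := max 4 (bigBoxes w (2 * T)).ncard with hK
  have hK4 : 4 ≤ K := le_max_left _ _
  have key : ∀ m : ℕ, ∀ t, T ≤ t → t ≤ 2 ^ (m + 1) * T →
      tailSum w t ≤ K * (bigBoxes w (2 * t) \ bigBoxes w t).ncard := by
    intro m
    induction m with
    | zero =>
      intro t ht ht2
      have e1 : tailSum w t ≤ K := by
        refine (tailSum_le_ncard hw t).trans (le_trans ?_ (le_max_right _ _))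
        exact_mod_cast Set.ncard_le_ncard (bigBoxes_mono hw0 (by simpa using ht2))
          (finite_bigBoxes hw _)
      have := h1 t ht
      nlinarith
    | succ m ih =>
      intro t ht ht2
      rcases le_total t (2 ^ (m + 1) * T) with h | h
      · exact ih t ht h
      obtain ⟨s, rfl⟩ : ∃ s, t = 2 * s := ⟨t / 2, by ring⟩
      have hs : T ≤ s := by
        have : (2 : ℝ) ≤ 2 ^ (m + 1) := le_self_pow₀ (by norm_num) (by omega)
        nlinarith
      have hs2 : s ≤ 2 ^ (m + 1) * T := by
        rw [pow_succ] at ht2; linarith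
      have e1 := ih s hs hs2
      have e2 := tailSum_two_mul_le hw0 hw (hT.le.trans hs)
      have e3 := h2 s hs
      have e4 := h1 s hs
      nlinarith
  refine ⟨K, by linarith, fun t ht => ?_⟩
  obtain ⟨m, hm⟩ := pow_unbounded_of_one_lt (t / T) (one_lt_two)
  refine key m t ht ?_
  rw [div_lt_iff₀ hT] at hm
  rw [pow_succ]
  linarith [mul_pos (pow_pos (zero_lt_two' ℝ) m) hT]

lemma exists_momentSum_half_le {j : ℕ} (hj : 1 ≤ j)
    (h : ∃ K : ℝ, 0 ≤ K ∧ ∀ᶠ t in atTop,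
      tailSum w t ≤ K * (bigBoxes w (2 * t) \ bigBoxes w t).ncard) :
    ∃ K : ℝ, 0 ≤ K ∧ ∀ᶠ t in atTop, momentSum w j (t / 2) ≤ K * momentSum w j t := by
  obtain ⟨K, hK, h⟩ := h
  set c : ℝ := (1 / 2) ^ j * Real.exp (-1) with hc
  have hc0 : 0 < c := by positivity
  refine ⟨Real.exp 1 + 4 * (j + 2).factorial * (K / c), by positivity, ?_⟩
  filter_upwards [h, eventually_ge_atTop 0] with t ht ht0
  have e1 := momentSum_half_le hw0 hw hj ht0
  have e2 := shell_le_momentSum hw0 hw hj ht0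
  rw [← hc] at e2
  have e3 : tailSum w t ≤ K / c * momentSum w j t := by
    refine ht.trans ?_
    rw [div_mul_eq_mul_div, le_div_iff₀ hc0]
    calc _ = K * (c * (bigBoxes w (2 * t) \ bigBoxes w t).ncard) := by ring
      _ ≤ _ := by gcongr
  calc _ ≤ _ := e1
    _ ≤ Real.exp 1 * momentSum w j t + 4 * (j + 2).factorial * (K / c * momentSum w j t) := by
      gcongr
    _ = _ := by ring

end Weights

/-! ### Regularity of the counting function and the size of the dyadic shells -/

lemma summable_toReal (p : PMF ℕ) : Summable fun k => (p k).toReal :=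
  ENNReal.summable_toReal p.tsum_coe_ne_top

lemma rho_eq_ncard (p : PMF ℕ) {t : ℝ} (ht : 0 ≤ t) :
    rho p t = (bigBoxes (fun k => (p k).toReal) t).ncard := by
  rw [rho]
  congr 2
  ext k
  simp only [bigBoxes, Set.mem_ofPred_eq]
  constructor
  · rintro ⟨h1, h2⟩
    rwa [div_le_iff₀ h1, mul_comm] at h2
  · intro h
    have h1 : 0 < (p k).toReal := by
      by_contra h0
      nlinarith [ENNReal.toReal_nonneg (a := p k)]
    exact ⟨h1, by rwa [div_le_iff₀ h1, mul_comm]⟩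

/-- Since ρ(2t) / ρ(t) → 2 ^ α > 1, the shell has at least (b - 1) ρ(t) elements for any fixed b
strictly between 1 and 2 ^ α, eventually. The crude bound of `tailSum` by ρ(t) is then enough. -/
lemma exists_tailSum_le_of_regularlyVarying (p : PMF ℕ) {α : ℝ} (hα : 0 < α)
    (h : RegularlyVarying α (rho p)) :
    ∃ K : ℝ, 0 ≤ K ∧ ∀ᶠ t in atTop, tailSum (fun k => (p k).toReal) t ≤
      K * (bigBoxes (fun k => (p k).toReal) (2 * t) \ bigBoxes (fun k => (p k).toReal) t).ncard := by
  obtain ⟨L, ⟨⟨T, hT, -⟩, hL⟩, hE⟩ := h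
  have hT' : ∀ᶠ t in atTop, 0 < L t := (eventually_ge_atTop T).mono hT
  have hu : ∀ᶠ t : ℝ in atTop, 0 < t ^ α * L t := by
    filter_upwards [hT', eventually_gt_atTop 0] with t h1 h2
    positivity
  have h2t : Tendsto (fun t : ℝ => 2 * t) atTop atTop := tendsto_id.const_mul_atTop two_pos
  have r1 := (isEquivalent_iff_tendsto_one (hu.mono fun t ht => ht.ne')).1 hE
  have r2 := r1.comp h2t
  have r3 : Tendsto (fun t : ℝ => 2 ^ α * (L (2 * t) / L t)) atTop (𝓝 (2 ^ α * 1)) :=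
    (hL 2 two_pos).const_mul _
  have r4 : Tendsto (fun t : ℝ => rho p (2 * t) / rho p t) atTop (𝓝 ((1 * (2 ^ α * 1)) / 1)) := by
    refine ((r2.mul r3).div r1 one_ne_zero).congr' ?_
    filter_upwards [hT', h2t.eventually hT', hu, h2t.eventually hu, eventually_gt_atTop 0]
      with t h1 h2 h3 h4 h5
    simp only [Function.comp_apply, Pi.div_apply]
    have : (2 * t) ^ α = 2 ^ α * t ^ α := Real.mul_rpow (by norm_num) h5.le
    rw [this]
    -- If ρ(t) = 0, both sides are quotients by 0 and equal 0 by convention.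
    by_cases h0 : rho p t = 0
    · simp [h0]
    have : 0 < t ^ α := Real.rpow_pos_of_pos h5 α
    have : (0 : ℝ) < 2 ^ α := by positivity
    field_simp
  have h1α : (1 : ℝ) < 2 ^ α := Real.one_lt_rpow one_lt_two hα
  simp only [one_mul, mul_one, div_one] at r4
  set b : ℝ := (1 + 2 ^ α) / 2 with hb
  have hb1 : 1 < b := by rw [hb]; linarith
  have r5 := r4.eventually_const_lt (show b < 2 ^ α by rw [hb]; linarith)
  refine ⟨1 / (b - 1), by have := sub_pos.2 hb1; positivity, ?_⟩
  filter_upwards [r5, eventually_gt_atTop 0] with t ht ht0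
  rw [ncard_shell (fun k => ENNReal.toReal_nonneg) (summable_toReal p) ht0.le,
    ← rho_eq_ncard p ht0.le, ← rho_eq_ncard p (by positivity)]
  refine (tailSum_le_ncard (summable_toReal p) t).trans ?_
  rw [← rho_eq_ncard p ht0.le, one_div_mul_eq_div, le_div_iff₀ (sub_pos.2 hb1)]
  have h0 : 0 ≤ rho p t := by rw [rho]; positivity
  have hpos : 0 < rho p t := by
    refine h0.lt_of_ne fun h => ?_
    rw [← h, div_zero] at ht
    linarith
  rw [lt_div_iff₀ hpos] at ht
  linarith

/-- The shell count D is asymptotic to ℓ log 2. Slow variation of ℓ gives D(2t) / D(t) → 1, hence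
D(t) ≤ 2 D(2t) eventually, and ℓ → ∞ gives D ≥ 1: these are the two hypotheses of
`exists_tailSum_le_shell`. -/
lemma exists_tailSum_le_of_deHaanInfty (p : PMF ℕ) (h : DeHaanInfty (rho p)) :
    ∃ K : ℝ, 0 ≤ K ∧ ∀ᶠ t in atTop, tailSum (fun k => (p k).toReal) t ≤
      K * (bigBoxes (fun k => (p k).toReal) (2 * t) \ bigBoxes (fun k => (p k).toReal) t).ncard := by
  obtain ⟨ℓ, ⟨⟨-, hℓ⟩, hd⟩, hinf⟩ := h
  set D : ℝ → ℝ := fun t => rho p (2 * t) - rho p t with hD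
  have h2t : Tendsto (fun t : ℝ => 2 * t) atTop atTop := tendsto_id.const_mul_atTop two_pos
  have hlog : 0 < Real.log 2 := Real.log_pos one_lt_two
  have r1 : Tendsto (fun t => D t / ℓ t) atTop (𝓝 (Real.log 2)) := hd 2 two_pos
  have hpos := hinf.eventually_gt_atTop 0
  have r2 : Tendsto D atTop atTop := by
    refine (r1.pos_mul_atTop hlog hinf).congr' ?_
    filter_upwards [hpos] with t ht
    field_simp
  have hDpos := r2.eventually_ge_atTop 1
  have r3 : Tendsto (fun t => D (2 * t) / D t) atTop
      (𝓝 ((Real.log 2 * 1) / Real.log 2)) := by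
    refine (((r1.comp h2t).mul (hℓ 2 two_pos)).div r1 hlog.ne').congr' ?_
    filter_upwards [hpos, h2t.eventually hpos, hDpos] with t h1 h2 h3
    simp only [Function.comp_apply, Pi.div_apply]
    have : D t ≠ 0 := by linarith
    field_simp
  rw [mul_one, div_self hlog.ne'] at r3
  have r4 := r3.eventually_const_lt (show (1 / 2 : ℝ) < 1 by norm_num)
  obtain ⟨T, hT⟩ := eventually_atTop.1 ((r4.and hDpos).and (eventually_gt_atTop 0))
  have hT0 : 0 < T := (hT T le_rfl).2
  have hDe : ∀ t, 0 ≤ t → ((bigBoxes (fun k => (p k).toReal) (2 * t) \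
      bigBoxes (fun k => (p k).toReal) t).ncard : ℝ) = D t := fun t ht => by
    rw [ncard_shell (fun k => ENNReal.toReal_nonneg) (summable_toReal p) ht,
      ← rho_eq_ncard p ht, ← rho_eq_ncard p (by positivity)]
  obtain ⟨K, hK, h⟩ := exists_tailSum_le_shell (w := fun k => (p k).toReal)
    (fun k => ENNReal.toReal_nonneg) (summable_toReal p) hT0
    (fun t ht => by rw [hDe t (hT0.le.trans ht)]; exact (hT t ht).1.2)
    (fun t ht => by
      have ht0 : 0 ≤ t := hT0.le.trans ht
      rw [hDe t ht0, hDe (2 * t) (by positivity)]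
      have e1 := (hT t ht).1.1
      have e2 := (hT t ht).1.2
      rw [lt_div_iff₀ (by linarith)] at e1
      linarith)
  exact ⟨K, hK, (eventually_ge_atTop T).mono h⟩

/-! ### The variance of a number of events -/

section Variance

variable {Ω : Type*} [MeasurableSpace Ω] {P : Measure Ω} [IsProbabilityMeasure P]

lemma tsum_measure_eq_ofReal {ι : Type*} {B : ι → Set Ω} (h : Summable fun i => P.real (B i)) :
    ∑' i, P (B i) = ENNReal.ofReal (∑' i, P.real (B i)) := by
  rw [ENNReal.ofReal_tsum_of_nonneg (fun i => measureReal_nonneg) h]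
  exact tsum_congr fun i => (ofReal_measureReal (measure_ne_top _ _)).symm

/-- The variance of the number of events that occur, as a double sum of covariances. -/
lemma variance_ncard_eq_tsum {A : ℕ → Set Ω} (hA : ∀ k, MeasurableSet (A k)) {N : Ω → ℝ}
    (hN : ∀ᵐ ω ∂P, N ω = ({k | ω ∈ A k}.ncard : ℝ)) (h₁ : Summable fun k => P.real (A k))
    (h₂ : Summable fun x : ℕ × ℕ => P.real (A x.1 ∩ A x.2)) :
    variance N P =
      ∑' x : ℕ × ℕ, (P.real (A x.1 ∩ A x.2) - P.real (A x.1) * P.real (A x.2)) := by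
  -- With values in `ENNReal` both moments come from Tonelli, without prior integrability.
  set Z : Ω → ENNReal := fun ω => ∑' k, (A k).indicator 1 ω with hZ
  have hZm : Measurable Z := Measurable.tsum fun k => measurable_one.indicator (hA k)
  -- Borel–Cantelli. It is needed because `ncard` of an infinite set is 0, which would not agree
  -- with Z.
  have hfin : ∀ᵐ ω ∂P, {k | ω ∈ A k}.Finite := by
    refine ae_finite_setOfPred_mem ?_
    rw [tsum_measure_eq_ofReal h₁]
    exact ENNReal.ofReal_ne_top
  have hNZ : N =ᵐ[P] fun ω => (Z ω).toReal := by
    filter_upwards [hN, hfin] with ω h hf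
    have : Z ω = {k | ω ∈ A k}.encard := by
      rw [← ENNReal.tsum_set_one, tsum_subtype {k | ω ∈ A k} fun _ => (1 : ENNReal)]
      refine tsum_congr fun k => ?_
      by_cases hk : ω ∈ A k <;> simp [hk]
    rw [h, this, ← hf.cast_ncard_eq]
    simp
  have e₁ : ∫⁻ ω, Z ω ∂P = ENNReal.ofReal (∑' k, P.real (A k)) := by
    rw [hZ, lintegral_tsum fun k => (measurable_one.indicator (hA k)).aemeasurable,
      ← tsum_measure_eq_ofReal h₁]
    exact tsum_congr fun k => lintegral_indicator_one (hA k)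
  have e₂ : ∫⁻ ω, Z ω ^ 2 ∂P = ENNReal.ofReal (∑' x : ℕ × ℕ, P.real (A x.1 ∩ A x.2)) := by
    have : ∀ ω, Z ω ^ 2 = ∑' x : ℕ × ℕ, (A x.1 ∩ A x.2).indicator 1 ω := by
      intro ω
      rw [ENNReal.tsum_prod', sq, hZ]
      simp only
      rw [← ENNReal.tsum_mul_right]
      refine tsum_congr fun k => ?_
      rw [← ENNReal.tsum_mul_left]
      refine tsum_congr fun l => ?_
      rw [Set.inter_indicator_one]; rfl
    simp_rw [this]
    have hm : ∀ x : ℕ × ℕ, MeasurableSet (A x.1 ∩ A x.2) := fun x => (hA x.1).inter (hA x.2)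
    rw [lintegral_tsum fun x => (measurable_one.indicator (hm x)).aemeasurable,
      ← tsum_measure_eq_ofReal h₂]
    exact tsum_congr fun x => lintegral_indicator_one (hm x)
  have i₁ : ∫ ω, (Z ω).toReal ∂P = ∑' k, P.real (A k) := by
    rw [integral_toReal hZm.aemeasurable, e₁,
      ENNReal.toReal_ofReal (tsum_nonneg fun _ => measureReal_nonneg)]
    refine ae_lt_top hZm ?_
    rw [e₁]; exact ENNReal.ofReal_ne_top
  have i₂ : ∫ ω, (Z ω ^ 2).toReal ∂P = ∑' x : ℕ × ℕ, P.real (A x.1 ∩ A x.2) := by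
    rw [integral_toReal (hZm.pow_const 2).aemeasurable, e₂,
      ENNReal.toReal_ofReal (tsum_nonneg fun _ => measureReal_nonneg)]
    refine ae_lt_top (hZm.pow_const 2) ?_
    rw [e₂]; exact ENNReal.ofReal_ne_top
  have hL : MemLp (fun ω => (Z ω).toReal) 2 P := by
    rw [memLp_two_iff_integrable_sq hZm.ennreal_toReal.aestronglyMeasurable]
    simp_rw [← ENNReal.toReal_pow]
    refine integrable_toReal_of_lintegral_ne_top (hZm.pow_const 2).aemeasurable ?_
    rw [e₂]; exact ENNReal.ofReal_ne_top
  rw [variance_congr hNZ, variance_eq_sub hL]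
  simp only [Pi.pow_apply, ← ENNReal.toReal_pow]
  have hs : Summable fun x : ℕ × ℕ => P.real (A x.1) * P.real (A x.2) :=
    h₁.mul_of_nonneg h₁ (fun _ => measureReal_nonneg) (fun _ => measureReal_nonneg)
  rw [i₁, i₂, h₂.tsum_sub hs, sq, h₁.tsum_mul_tsum h₁ hs]

end Variance

/-! ### Occupancy events of the deterministic scheme -/

section Deterministic

variable {Ω : Type*}

/-- The balls among the first `n` that hit the box `k`. -/
def ballsIn (X : ℕ → Ω → ℕ) (n k : ℕ) (ω : Ω) : Finset ℕ :=
  (Finset.range n).filter fun i => X i ω = k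

/-- The event that the box `k` contains exactly `j` of the first `n` balls. -/
def detEvent (X : ℕ → Ω → ℕ) (j n k : ℕ) : Set Ω := {ω | (ballsIn X n k ω).card = j}

lemma encard_eq_iff_card_ballsIn {X : ℕ → Ω → ℕ} {j n k : ℕ} {ω : Ω} :
    {i : ℕ | i ∈ {i : ℕ | i < n} ∧ X i ω = k}.encard = (j : ℕ∞) ↔ ω ∈ detEvent X j n k := by
  have : {i : ℕ | i ∈ {i : ℕ | i < n} ∧ X i ω = k} = (ballsIn X n k ω : Set ℕ) := by
    ext i; simp [ballsIn]
  rw [this, Set.encard_coe_eq_coe_finsetCard, detEvent]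
  exact Nat.cast_inj

lemma detCount_eq_ncard (X : ℕ → Ω → ℕ) (j n : ℕ) (ω : Ω) :
    detCount X j n ω = ({k | ω ∈ detEvent X j n k}.ncard : ℝ) := by
  rw [detCount, numExactly]
  congr 2
  ext k
  exact encard_eq_iff_card_ballsIn


/-- The event that the ball `i` falls into `s i` for all `i < n`. -/
def cylinderEvent (X : ℕ → Ω → ℕ) (n : ℕ) (s : ℕ → Set ℕ) : Set Ω :=
  ⋂ i ∈ Finset.range n, X i ⁻¹' s i

lemma mem_cylinderEvent {X : ℕ → Ω → ℕ} {n : ℕ} {s : ℕ → Set ℕ} {ω : Ω} :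
    ω ∈ cylinderEvent X n s ↔ ∀ i < n, X i ω ∈ s i := by
  simp [cylinderEvent]

lemma ballsIn_eq_iff {X : ℕ → Ω → ℕ} {n k : ℕ} {ω : Ω} {A : Finset ℕ}
    (hA : A ⊆ Finset.range n) : ballsIn X n k ω = A ↔ ∀ i < n, (X i ω = k ↔ i ∈ A) := by
  rw [ballsIn, Finset.ext_iff]
  refine forall_congr' fun i => ?_
  have := @hA i
  simp only [Finset.mem_filter, Finset.mem_range] at this ⊢
  tauto

lemma detEvent_eq_biUnion (X : ℕ → Ω → ℕ) (j n k : ℕ) :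
    detEvent X j n k = ⋃ A ∈ Finset.powersetCard j (Finset.range n), {ω | ballsIn X n k ω = A} := by
  ext ω
  simp only [detEvent, Set.mem_ofPred_eq, Set.mem_iUnion, Finset.mem_powersetCard, exists_prop]
  constructor
  · exact fun h => ⟨_, ⟨Finset.filter_subset _ _, h⟩, rfl⟩
  · rintro ⟨A, ⟨-, h⟩, rfl⟩
    exact h

lemma setOf_ballsIn_eq (X : ℕ → Ω → ℕ) {n : ℕ} (k : ℕ) {A : Finset ℕ}
    (hA : A ⊆ Finset.range n) : {ω | ballsIn X n k ω = A} =
      cylinderEvent X n fun i => if i ∈ A then {k} else {k}ᶜ := by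
  ext ω
  rw [Set.mem_ofPred_eq, ballsIn_eq_iff hA, mem_cylinderEvent]
  refine forall₂_congr fun i _ => ?_
  by_cases h : i ∈ A <;> simp [h]

lemma setOf_ballsIn_eq_and_eq (X : ℕ → Ω → ℕ) {n k l : ℕ} (hkl : k ≠ l) {A B : Finset ℕ}
    (hA : A ⊆ Finset.range n) (hB : B ⊆ Finset.range n \ A) :
    {ω | ballsIn X n k ω = A ∧ ballsIn X n l ω = B} =
      cylinderEvent X n fun i => if i ∈ A then {k} else if i ∈ B then {l} else {k, l}ᶜ := by
  ext ω
  rw [Set.mem_ofPred_eq, ballsIn_eq_iff hA, ballsIn_eq_iff (hB.trans Finset.sdiff_subset),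
    mem_cylinderEvent]
  rw [← forall₂_and]
  refine forall₂_congr fun i _ => ?_
  have hi := @hB i
  simp only [Finset.mem_sdiff] at hi
  by_cases h : i ∈ A
  · have h' : i ∉ B := fun h' => (hi h').2 h
    simp only [h, h', if_true, iff_true, iff_false, Set.mem_singleton_iff]
    constructor
    · exact fun h => h.1
    · exact fun h => ⟨h, fun h' => hkl (h.symm.trans h')⟩
  · by_cases h' : i ∈ B
    · simp only [h, h', if_true, if_false, iff_true, iff_false, Set.mem_singleton_iff]
      constructor
      · exact fun h => h.2
      · exact fun h => ⟨fun h' => hkl (h'.symm.trans h), h⟩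
    · simp [h, h']

lemma detEvent_inter_eq_biUnion (X : ℕ → Ω → ℕ) (j n : ℕ) {k l : ℕ} (hkl : k ≠ l) :
    detEvent X j n k ∩ detEvent X j n l =
      ⋃ x ∈ (Finset.powersetCard j (Finset.range n)).sigma
        fun A => Finset.powersetCard j (Finset.range n \ A),
        {ω | ballsIn X n k ω = x.1 ∧ ballsIn X n l ω = x.2} := by
  ext ω
  simp only [detEvent, Set.mem_inter_iff, Set.mem_ofPred_eq, Set.mem_iUnion, Finset.mem_sigma,
    Finset.mem_powersetCard, exists_prop]
  constructor
  · rintro ⟨h1, h2⟩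
    refine ⟨⟨ballsIn X n k ω, ballsIn X n l ω⟩,
      ⟨⟨Finset.filter_subset _ _, h1⟩, fun i hi => ?_, h2⟩, rfl, rfl⟩
    simp only [ballsIn, Finset.mem_filter, Finset.mem_sdiff] at hi ⊢
    exact ⟨hi.1, fun h => hkl (h.2.symm.trans hi.2)⟩
  · rintro ⟨x, ⟨⟨-, h1⟩, -, h2⟩, h3, h4⟩
    rw [h3, h4]
    exact ⟨h1, h2⟩

variable [MeasurableSpace Ω]

lemma measurableSet_cylinderEvent {X : ℕ → Ω → ℕ} (hX : ∀ i, Measurable (X i)) (n : ℕ)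
    (s : ℕ → Set ℕ) : MeasurableSet (cylinderEvent X n s) :=
  Finset.measurableSet_biInter _ fun i _ => hX i (MeasurableSet.of_discrete)

lemma measurableSet_detEvent {X : ℕ → Ω → ℕ} (hX : ∀ i, Measurable (X i)) (j n k : ℕ) :
    MeasurableSet (detEvent X j n k) := by
  rw [detEvent_eq_biUnion]
  refine Finset.measurableSet_biUnion _ fun A hA => ?_
  rw [setOf_ballsIn_eq X k (Finset.mem_powersetCard.1 hA).1]
  exact measurableSet_cylinderEvent hX _ _

variable {P : Measure Ω} {p : PMF ℕ} {X : ℕ → Ω → ℕ}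

lemma IsAllocation.measureReal_cylinderEvent (hX : IsAllocation p P X) (n : ℕ) (s : ℕ → Set ℕ) :
    P.real (cylinderEvent X n s) = ∏ i ∈ Finset.range n, p.toMeasure.real (s i) := by
  rw [measureReal_def, cylinderEvent, hX.indep.measure_inter_preimage_eq_mul _
    (fun i _ => MeasurableSet.of_discrete), ENNReal.toReal_prod]
  refine Finset.prod_congr rfl fun i _ => ?_
  rw [measureReal_def, ← hX.law i, Measure.map_apply (hX.measurable i) MeasurableSet.of_discrete]

lemma toMeasure_real_singleton (p : PMF ℕ) (k : ℕ) : p.toMeasure.real {k} = (p k).toReal := by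
  rw [measureReal_def, PMF.toMeasure_apply_singleton _ _ (measurableSet_singleton k)]

lemma toMeasure_real_singleton_compl (p : PMF ℕ) (k : ℕ) :
    p.toMeasure.real {k}ᶜ = 1 - (p k).toReal := by
  rw [measureReal_compl (measurableSet_singleton k), toMeasure_real_singleton]
  simp

lemma toMeasure_real_pair_compl (p : PMF ℕ) {k l : ℕ} (hkl : k ≠ l) :
    p.toMeasure.real {k, l}ᶜ = 1 - (p k).toReal - (p l).toReal := by
  rw [measureReal_compl MeasurableSet.of_discrete, Set.insert_eq,
    measureReal_union (by simpa using hkl) (measurableSet_singleton l), toMeasure_real_singleton,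
    toMeasure_real_singleton]
  simp
  ring

lemma add_toReal_le_one (p : PMF ℕ) {k l : ℕ} (hkl : k ≠ l) :
    (p k).toReal + (p l).toReal ≤ 1 := by
  have := toMeasure_real_pair_compl p hkl
  have h0 : 0 ≤ p.toMeasure.real ({k, l}ᶜ : Set ℕ) := measureReal_nonneg
  linarith

lemma toReal_le_one (p : PMF ℕ) (k : ℕ) : (p k).toReal ≤ 1 := by
  have := add_toReal_le_one p (Nat.succ_ne_self k).symm
  have := ENNReal.toReal_nonneg (a := p k.succ)
  linarith

/-- The number of balls in a given box is binomially distributed. -/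
lemma IsAllocation.measureReal_detEvent [IsFiniteMeasure P] (hX : IsAllocation p P X)
    (j n k : ℕ) : P.real (detEvent X j n k) = binomialWeight j n (p k).toReal := by
  have hmem : ∀ A ∈ Finset.powersetCard j (Finset.range n), A ⊆ Finset.range n :=
    fun A hA => (Finset.mem_powersetCard.1 hA).1
  rw [detEvent_eq_biUnion, measureReal_biUnion_finset]
  · rw [Finset.sum_congr rfl (g := fun _ => (p k).toReal ^ j * (1 - (p k).toReal) ^ (n - j))]
    · rw [Finset.sum_const, Finset.card_powersetCard, Finset.card_range, nsmul_eq_mul,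
        binomialWeight, mul_assoc]
    · intro A hA
      rw [setOf_ballsIn_eq X k (hmem A hA), hX.measureReal_cylinderEvent]
      simp_rw [apply_ite (fun s : Set ℕ => p.toMeasure.real s), toMeasure_real_singleton,
        toMeasure_real_singleton_compl]
      rw [Finset.prod_ite, Finset.prod_const, Finset.prod_const,
        Finset.filter_mem_eq_inter, Finset.inter_eq_right.2 (hmem A hA), Finset.filter_notMem_eq_sdiff,
        Finset.card_sdiff_of_subset (hmem A hA), Finset.card_range, (Finset.mem_powersetCard.1 hA).2]
  · intro A _ B _ hAB
    exact Set.disjoint_left.2 fun ω h1 h2 => hAB (h1.symm.trans h2)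
  · intro A hA
    rw [setOf_ballsIn_eq X k (hmem A hA)]
    exact measurableSet_cylinderEvent hX.measurable _ _

/-- The numbers of balls in two given boxes are trinomially distributed. -/
lemma IsAllocation.measureReal_detEvent_inter [IsFiniteMeasure P] (hX : IsAllocation p P X)
    (j n : ℕ) {k l : ℕ} (hkl : k ≠ l) :
    P.real (detEvent X j n k ∩ detEvent X j n l) =
      trinomialWeight j n (p k).toReal (p l).toReal := by
  rw [detEvent_inter_eq_biUnion X j n hkl, measureReal_biUnion_finset]
  · rw [Finset.sum_sigma]
    rw [Finset.sum_congr rfl (g := fun _ => ((n - j).choose j : ℝ) * ((p k).toReal ^ j *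
      (p l).toReal ^ j * (1 - (p k).toReal - (p l).toReal) ^ (n - 2 * j)))]
    · rw [Finset.sum_const, Finset.card_powersetCard, Finset.card_range, nsmul_eq_mul,
        trinomialWeight]
      ring
    · intro A hA
      obtain ⟨hA1, hA2⟩ := Finset.mem_powersetCard.1 hA
      have hcard : (Finset.range n \ A).card = n - j := by
        rw [Finset.card_sdiff_of_subset hA1, Finset.card_range, hA2]
      rw [Finset.sum_congr rfl (g := fun _ => (p k).toReal ^ j *
        (p l).toReal ^ j * (1 - (p k).toReal - (p l).toReal) ^ (n - 2 * j))]
      · rw [Finset.sum_const, Finset.card_powersetCard, hcard, nsmul_eq_mul]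
      intro B hB
      obtain ⟨hB1, hB2⟩ := Finset.mem_powersetCard.1 hB
      rw [setOf_ballsIn_eq_and_eq X hkl hA1 hB1, hX.measureReal_cylinderEvent]
      simp_rw [apply_ite (fun s : Set ℕ => p.toMeasure.real s), toMeasure_real_singleton,
        toMeasure_real_pair_compl p hkl]
      rw [Finset.prod_ite, Finset.prod_const, Finset.filter_mem_eq_inter,
        Finset.inter_eq_right.2 hA1, Finset.filter_notMem_eq_sdiff, Finset.prod_ite,
        Finset.prod_const, Finset.prod_const, Finset.filter_mem_eq_inter,
        Finset.inter_eq_right.2 hB1, Finset.filter_notMem_eq_sdiff,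
        Finset.card_sdiff_of_subset hB1, hcard, hA2, hB2, ← mul_assoc]
      congr 2
      omega
  · rintro ⟨A, B⟩ _ ⟨A', B'⟩ _ hne
    refine Set.disjoint_left.2 ?_
    rintro ω ⟨h1, h2⟩ ⟨h3, h4⟩
    simp only at h1 h2 h3 h4
    subst h1 h2 h3 h4
    exact hne rfl
  · rintro ⟨A, B⟩ h
    simp only [Finset.mem_sigma, Finset.mem_powersetCard] at h
    rw [setOf_ballsIn_eq_and_eq X hkl h.1.1 h.2.1]
    exact measurableSet_cylinderEvent hX.measurable _ _

end Deterministic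

/-! ### The number of balls thrown in the Poissonized scheme -/

/-- The probability that a Poisson variable with mean `t` is less than `n`. -/
def poissonTail (n : ℕ) (t : ℝ) : ℝ := ∑ m ∈ Finset.range n, poissonWeight m t

lemma continuous_poissonWeight (j : ℕ) : Continuous (poissonWeight j) := by
  unfold poissonWeight
  fun_prop

lemma intervalIntegral_exp_mul_poissonWeight (m : ℕ) (t : ℝ) :
    ∫ s in (0 : ℝ)..t, Real.exp (-s) * poissonWeight m (t - s) = poissonWeight (m + 1) t := by
  have h : ∀ s : ℝ, Real.exp (-s) * poissonWeight m (t - s) =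
      Real.exp (-t) / (m.factorial : ℝ) * (t - s) ^ m := by
    intro s
    unfold poissonWeight
    have : Real.exp (-t) = Real.exp (-s) * Real.exp (-(t - s)) := by
      rw [← Real.exp_add]; ring_nf
    rw [this]
    ring
  simp_rw [h]
  rw [intervalIntegral.integral_const_mul,
    intervalIntegral.integral_comp_sub_left (fun x : ℝ => x ^ m) t]
  simp only [sub_self, sub_zero, integral_pow]
  unfold poissonWeight
  rw [Nat.factorial_succ]
  push_cast
  field_simp
  ring

/-- The renewal recursion: s is the value of one exponential jump, and exp (-t) is the probability
that this jump alone exceeds t. -/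
lemma intervalIntegral_exp_mul_poissonTail (n : ℕ) (t : ℝ) :
    (∫ s in (0 : ℝ)..t, Real.exp (-s) * poissonTail n (t - s)) + Real.exp (-t) =
      poissonTail (n + 1) t := by
  unfold poissonTail
  simp_rw [Finset.mul_sum]
  rw [intervalIntegral.integral_finsetSum, Finset.sum_range_succ']
  · congr 1
    · exact Finset.sum_congr rfl fun m _ => intervalIntegral_exp_mul_poissonWeight m t
    · simp [poissonWeight]
  · intro m _
    have := continuous_poissonWeight m
    exact Continuous.intervalIntegrable (by fun_prop) _ _

lemma integral_expMeasure (f : ℝ → ℝ) :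
    ∫ s, f s ∂(expMeasure 1) = ∫ s in Set.Ioi 0, Real.exp (-s) * f s := by
  rw [expMeasure, gammaMeasure, integral_withDensity_eq_integral_toReal_smul
    (show Measurable (gammaPDF 1 1) from (measurable_gammaPDFReal 1 1).ennreal_ofReal)
    (by simp [gammaPDF]),
    ← integral_Ici_eq_integral_Ioi, ← integral_indicator measurableSet_Ici]
  refine integral_congr_ae (Eventually.of_forall fun s => ?_)
  change (exponentialPDF 1 s).toReal • f s = _
  rw [exponentialPDF_eq]
  by_cases hs : 0 ≤ s
  · rw [Set.indicator_of_mem (Set.mem_Ici.2 hs), if_pos hs, ENNReal.toReal_ofReal (by positivity)]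
    simp
  · rw [Set.indicator_of_notMem (by simpa using hs), if_neg hs]
    simp

section Arrivals

variable {Ω : Type*} [MeasurableSpace Ω] {P : Measure Ω} {E : ℕ → Ω → ℝ}

/-- The random walk with jumps `E`. -/
def partialSum (E : ℕ → Ω → ℝ) (n : ℕ) (ω : Ω) : ℝ := ∑ m ∈ Finset.range n, E m ω

lemma measurable_partialSum (hE : ∀ i, Measurable (E i)) (n : ℕ) : Measurable (partialSum E n) :=
  Finset.measurable_fun_sum _ fun m _ => hE m

lemma IsExpSequence.ae_nonneg (hE : IsExpSequence P E) : ∀ᵐ ω ∂P, ∀ i, 0 ≤ E i ω := by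
  rw [ae_all_iff]
  intro i
  have h : ∀ᵐ x ∂(expMeasure 1), 0 ≤ x := by
    rw [ae_iff, show {x : ℝ | ¬ 0 ≤ x} = Set.Iio 0 by ext; simp, expMeasure, gammaMeasure,
      withDensity_apply _ measurableSet_Iio]
    exact lintegral_gammaPDF_of_nonpos le_rfl
  rw [← hE.law i] at h
  exact ae_of_ae_map (hE.measurable i).aemeasurable h

omit [MeasurableSpace Ω] in
lemma monotone_partialSum {ω : Ω} (h : ∀ i, 0 ≤ E i ω) : Monotone fun n => partialSum E n ω :=
  monotone_nat_of_le_succ fun n => by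
    simp only [partialSum, Finset.sum_range_succ]
    linarith [h n]

/-- The gamma distribution function: `n` arrivals need more than time `t` if and only if a Poisson
variable with mean `t` is less than `n`. -/
lemma IsExpSequence.measureReal_lt_partialSum [IsProbabilityMeasure P] (hE : IsExpSequence P E)
    (n : ℕ) : ∀ t : ℝ, 0 ≤ t → P.real {ω | t < partialSum E n ω} = poissonTail n t := by
  induction n with
  | zero =>
    intro t ht
    simp [partialSum, poissonTail, not_lt.2 ht]
  | succ n ih =>
    intro t ht
    have hRm := measurable_partialSum hE.measurable n
    have hneg : ∀ u : ℝ, u < 0 → P.real {ω | u < partialSum E n ω} = 1 := by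
      intro u hu
      rw [measureReal_def, (mem_ae_iff_prob_eq_one
        (measurableSet_lt measurable_const hRm)).1, ENNReal.toReal_one]
      filter_upwards [hE.ae_nonneg] with ω h
      exact hu.trans_le (Finset.sum_nonneg fun m _ => h m)
    -- Condition on the last jump: it is independent of the preceding partial sum, so the tail of
    -- S_(n+1) is a convolution.
    have hind : IndepFun (partialSum E n) (E n) P := by
      have := hE.indep.indepFun_finsetSum_of_notMem hE.measurable (s := Finset.range n) (i := n)
        (by simp)
      convert this using 1
      ext ω
      simp [partialSum]
    have := isProbabilityMeasure_expMeasure one_pos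
    have hmap := (indepFun_iff_map_prod_eq_prod_map_map hRm.aemeasurable
      (hE.measurable n).aemeasurable).1 hind
    rw [hE.law n] at hmap
    have hS : MeasurableSet {x : ℝ × ℝ | t < x.1 + x.2} :=
      measurableSet_lt measurable_const (measurable_fst.add measurable_snd)
    have hPm : IsProbabilityMeasure (P.map (partialSum E n)) :=
      Measure.isProbabilityMeasure_map hRm.aemeasurable
    have h1 : P.real {ω | t < partialSum E (n + 1) ω} =
        ∫ s, P.real {ω | t - s < partialSum E n ω} ∂(expMeasure 1) := by
      have e : {ω | t < partialSum E (n + 1) ω} =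
          (fun ω => (partialSum E n ω, E n ω)) ⁻¹' {x : ℝ × ℝ | t < x.1 + x.2} := by
        ext ω
        simp [partialSum, Finset.sum_range_succ]
      rw [measureReal_def, e, ← Measure.map_apply (hRm.prodMk (hE.measurable n)) hS, hmap,
        Measure.prod_apply_symm hS, ← integral_toReal]
      · refine integral_congr_ae (Eventually.of_forall fun s => ?_)
        simp only
        rw [Measure.map_apply hRm (measurable_prodMk_right hS), measureReal_def]
        congr 2
        ext ω
        simp [sub_lt_iff_lt_add]
      · exact (measurable_measure_prodMk_right hS).aemeasurable
      · exact Eventually.of_forall fun s => measure_lt_top _ _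
    rw [h1, integral_expMeasure, ← intervalIntegral_exp_mul_poissonTail,
      ← Set.Ioc_union_Ioi_eq_Ioi ht]
    have c1 : Set.EqOn (fun s => Real.exp (-s) * P.real {ω | t - s < partialSum E n ω})
        (fun s => Real.exp (-s) * poissonTail n (t - s)) (Set.Ioc 0 t) := by
      intro s hs
      simp only
      rw [ih _ (sub_nonneg.2 hs.2)]
    have c2 : Set.EqOn (fun s => Real.exp (-s) * P.real {ω | t - s < partialSum E n ω})
        (fun s => Real.exp (-s)) (Set.Ioi t) := by
      intro s hs
      simp only
      rw [hneg _ (sub_neg.2 hs), mul_one]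
    have hcont : Continuous fun s => Real.exp (-s) * poissonTail n (t - s) := by
      have : Continuous (poissonTail n) :=
        continuous_finsetSum _ fun m _ => continuous_poissonWeight m
      fun_prop
    rw [setIntegral_union (Set.Ioc_disjoint_Ioi le_rfl) measurableSet_Ioi,
      setIntegral_congr_fun measurableSet_Ioc c1, setIntegral_congr_fun measurableSet_Ioi c2,
      integral_exp_neg_Ioi, intervalIntegral.integral_of_le ht]
    · exact (integrableOn_congr_fun c1 measurableSet_Ioc).2
        (hcont.integrableOn_Icc.mono_set Set.Ioc_subset_Icc_self)
    · exact (integrableOn_congr_fun c2 measurableSet_Ioi).2 (integrableOn_exp_neg_Ioi t)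

/-- The event that exactly the first `n` balls are thrown up to time `t`. -/
def countEvent (E : ℕ → Ω → ℝ) (t : ℝ) (n : ℕ) : Set Ω :=
  {ω | {i : ℕ | throwTime E i ω ≤ t} = {i : ℕ | i < n}}

omit [MeasurableSpace Ω] in
lemma pairwise_disjoint_countEvent (E : ℕ → Ω → ℝ) (t : ℝ) :
    Pairwise (Function.onFun Disjoint (countEvent E t)) := by
  intro n m hnm
  refine Set.disjoint_left.2 fun ω (h1 : _ = _) (h2 : _ = _) => hnm ?_
  exact Set.Iio_injective (h1.symm.trans h2)

lemma measurableSet_countEvent (hE : ∀ i, Measurable (E i)) (t : ℝ) (n : ℕ) :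
    MeasurableSet (countEvent E t n) := by
  have : countEvent E t n = ⋂ i, {ω | throwTime E i ω ≤ t ↔ i < n} := by
    ext ω
    simp [countEvent, Set.ext_iff]
  rw [this]
  refine MeasurableSet.iInter fun i => ?_
  have h : MeasurableSet {ω | throwTime E i ω ≤ t} :=
    measurableSet_le (measurable_partialSum hE (i + 1)) measurable_const
  by_cases hi : i < n
  · simpa [hi] using h
  · simp only [hi, iff_false]
    exact h.compl

/-- The number of balls thrown up to time `t` has the Poisson distribution. -/
lemma IsExpSequence.measureReal_countEvent [IsProbabilityMeasure P] (hE : IsExpSequence P E)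
    {t : ℝ} (ht : 0 ≤ t) (n : ℕ) : P.real (countEvent E t n) = poissonWeight n t := by
  -- Off the null set where some jump is negative the walk is monotone, and the event is S_n ≤ t <
  -- S_(n+1). Ball i is thrown at S_(i+1); for n = 0 the condition S_0 ≤ t is 0 ≤ t.
  have hae : countEvent E t n =ᵐ[P]
      ({ω | t < partialSum E (n + 1) ω} \ {ω | t < partialSum E n ω} : Set Ω) := by
    filter_upwards [hE.ae_nonneg] with ω h
    have hmono := monotone_partialSum h
    refine propext ?_
    change {i : ℕ | throwTime E i ω ≤ t} = {i : ℕ | i < n} ↔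
      t < partialSum E (n + 1) ω ∧ ¬ t < partialSum E n ω
    rw [Set.ext_iff]
    change (∀ i, partialSum E (i + 1) ω ≤ t ↔ i < n) ↔ _
    rw [not_lt]
    constructor
    · intro hi
      refine ⟨not_le.1 fun hle => lt_irrefl n ((hi n).1 hle), ?_⟩
      rcases n with _ | n
      · simpa [partialSum] using ht
      · exact (hi n).2 (Nat.lt_succ_self n)
    · rintro ⟨h1, h2⟩ i
      constructor
      · intro hi
        by_contra hni
        exact absurd (h1.trans_le (hmono (show n + 1 ≤ i + 1 by omega))) (not_lt.2 hi)
      · exact fun hi => (hmono (show i + 1 ≤ n by omega)).trans h2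
  have hB : MeasurableSet {ω | t < partialSum E n ω} :=
    measurableSet_lt measurable_const (measurable_partialSum hE.measurable n)
  have hAB : ({ω | t < partialSum E (n + 1) ω} ∩ {ω | t < partialSum E n ω} : Set Ω) =ᵐ[P]
      {ω | t < partialSum E n ω} := by
    filter_upwards [hE.ae_nonneg] with ω h
    refine propext ⟨fun h => h.2, fun h' => ⟨?_, h'⟩⟩
    exact lt_of_lt_of_le h' (monotone_partialSum h n.le_succ)
  have h := measureReal_inter_add_sdiff (μ := P) (s := {ω | t < partialSum E (n + 1) ω}) hB
  rw [measureReal_congr hAB, hE.measureReal_lt_partialSum _ _ ht,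
    hE.measureReal_lt_partialSum _ _ ht, poissonTail, poissonTail, Finset.sum_range_succ] at h
  rw [measureReal_congr hae]
  linarith

lemma hasSum_poissonWeight (t : ℝ) : HasSum (fun n => poissonWeight n t) 1 := by
  have h := (NormedSpace.expSeries_div_hasSum_exp t).mul_left (Real.exp (-t))
  rw [← Real.exp_eq_exp_ℝ, ← Real.exp_add, neg_add_cancel, Real.exp_zero] at h
  exact h.congr_fun fun n => by rw [poissonWeight, mul_div_assoc]

/-- The events are disjoint and their Poisson probabilities add up to 1. Hence almost surely only
finitely many balls are thrown by time t, and no law of large numbers is required. -/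
lemma IsExpSequence.ae_exists_countEvent [IsProbabilityMeasure P] (hE : IsExpSequence P E)
    {t : ℝ} (ht : 0 ≤ t) : ∀ᵐ ω ∂P, ∃ n, ω ∈ countEvent E t n := by
  have hm := measurableSet_countEvent hE.measurable t
  have h : P (⋃ n, countEvent E t n) = 1 := by
    rw [measure_iUnion (pairwise_disjoint_countEvent E t) hm,
      tsum_measure_eq_ofReal]
    · simp_rw [hE.measureReal_countEvent ht]
      rw [(hasSum_poissonWeight t).tsum_eq, ENNReal.ofReal_one]
    · simp_rw [hE.measureReal_countEvent ht]
      exact (hasSum_poissonWeight t).summable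
  filter_upwards [(mem_ae_iff_prob_eq_one (MeasurableSet.iUnion hm)).2 h] with ω hω
  exact Set.mem_iUnion.1 hω

end Arrivals

/-! ### Poisson mixtures of the multinomial weights -/

/-- Poisson thinning: after the shift n = m + j the sum over m is the exponential series at t (1 -
a). -/
lemma hasSum_poissonWeight_mul_binomialWeight (j : ℕ) (t a : ℝ) :
    HasSum (fun n => poissonWeight n t * binomialWeight j n a) (poissonWeight j (a * t)) := by
  have hinj : Function.Injective fun m : ℕ => m + j := add_left_injective j
  rw [← hinj.hasSum_iff]
  · have h := (NormedSpace.expSeries_div_hasSum_exp (t * (1 - a))).mul_left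
      (Real.exp (-t) * t ^ j * a ^ j / j.factorial)
    rw [← Real.exp_eq_exp_ℝ] at h
    have e : poissonWeight j (a * t) =
        Real.exp (-t) * t ^ j * a ^ j / j.factorial * Real.exp (t * (1 - a)) := by
      rw [poissonWeight, show -(a * t) = -t + t * (1 - a) by ring, Real.exp_add]
      ring
    rw [e]
    refine h.congr_fun fun m => ?_
    simp only [Function.comp_apply, poissonWeight, binomialWeight, Nat.add_sub_cancel]
    have hc : ((m + j).choose j : ℝ) * (m.factorial * j.factorial) = (m + j).factorial := by
      have := Nat.add_choose_mul_factorial_mul_factorial m j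
      rw [← mul_assoc]
      exact_mod_cast this
    rw [← hc]
    have : ((m + j).choose j : ℝ) ≠ 0 := by
      exact_mod_cast (Nat.choose_pos (Nat.le_add_left j m)).ne'
    rw [mul_pow t]
    field_simp
    ring
  · intro n hn
    have : n < j := by
      by_contra h
      exact hn ⟨n - j, by simp only; omega⟩
    simp [binomialWeight, Nat.choose_eq_zero_of_lt this]

/-- The product form on the right is the independence of two boxes after Poissonization. It arises
from the exponential series at t (1 - a - b), after the shift n = m + 2 j. -/
lemma hasSum_poissonWeight_mul_trinomialWeight (j : ℕ) (t a b : ℝ) :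
    HasSum (fun n => poissonWeight n t * trinomialWeight j n a b)
      (poissonWeight j (a * t) * poissonWeight j (b * t)) := by
  have hinj : Function.Injective fun m : ℕ => m + 2 * j := add_left_injective (2 * j)
  rw [← hinj.hasSum_iff]
  · have h := (NormedSpace.expSeries_div_hasSum_exp (t * (1 - a - b))).mul_left
      (Real.exp (-t) * t ^ (2 * j) * a ^ j * b ^ j / (j.factorial ^ 2))
    rw [← Real.exp_eq_exp_ℝ] at h
    have e : poissonWeight j (a * t) * poissonWeight j (b * t) =
        Real.exp (-t) * t ^ (2 * j) * a ^ j * b ^ j / (j.factorial ^ 2) *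
          Real.exp (t * (1 - a - b)) := by
      rw [poissonWeight, poissonWeight]
      have : Real.exp (-(a * t)) * Real.exp (-(b * t)) =
          Real.exp (-t) * Real.exp (t * (1 - a - b)) := by
        rw [← Real.exp_add, ← Real.exp_add]; ring_nf
      calc _ = Real.exp (-(a * t)) * Real.exp (-(b * t)) * ((a * t) ^ j * (b * t) ^ j /
            (j.factorial ^ 2)) := by ring
        _ = _ := by rw [this]; ring
    rw [e]
    refine h.congr_fun fun m => ?_
    simp only [Function.comp_apply, poissonWeight, trinomialWeight, Nat.add_sub_cancel]
    have hc : ((m + 2 * j).choose j : ℝ) * ((m + 2 * j - j).choose j) *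
        (m.factorial * j.factorial ^ 2) = (m + 2 * j).factorial := by
      have h1 := Nat.choose_mul_factorial_mul_factorial (show j ≤ m + 2 * j by omega)
      have h2 := Nat.choose_mul_factorial_mul_factorial (show j ≤ m + 2 * j - j by omega)
      rw [show m + 2 * j - j - j = m by omega] at h2
      rw [← h2] at h1
      rw [← h1]
      push_cast
      ring
    rw [← hc]
    have h1 : ((m + 2 * j).choose j : ℝ) ≠ 0 := by
      exact_mod_cast (Nat.choose_pos (by omega)).ne'
    have h2 : ((m + 2 * j - j).choose j : ℝ) ≠ 0 := by
      exact_mod_cast (Nat.choose_pos (by omega)).ne'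
    rw [mul_pow t]
    field_simp
    ring
  · intro n hn
    have : n < 2 * j := by
      by_contra h
      exact hn ⟨n - 2 * j, by simp only; omega⟩
    rw [trinomialWeight]
    rcases lt_or_ge n j with h | h
    · simp [Nat.choose_eq_zero_of_lt h]
    · simp [Nat.choose_eq_zero_of_lt (show n - j < j by omega)]

/-! ### Occupancy events of the Poissonized scheme -/

section Poissonized

variable {Ω : Type*} [MeasurableSpace Ω] {P : Measure Ω} [IsProbabilityMeasure P] {p : PMF ℕ}
  {X : ℕ → Ω → ℕ} {E : ℕ → Ω → ℝ}

/-- The event that finitely many balls are thrown up to time `t`, exactly `j` of which fall into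
the box `k`. -/
def poissonEvent (X : ℕ → Ω → ℕ) (E : ℕ → Ω → ℝ) (j : ℕ) (t : ℝ) (k : ℕ) : Set Ω :=
  ⋃ n, detEvent X j n k ∩ countEvent E t n

omit [IsProbabilityMeasure P] in
lemma IsPoissonizedScheme.measurableSet_poissonEvent (h : IsPoissonizedScheme p P X E) (j : ℕ)
    (t : ℝ) (k : ℕ) : MeasurableSet (poissonEvent X E j t k) :=
  MeasurableSet.iUnion fun n => (measurableSet_detEvent h.allocation.measurable j n k).inter
    (measurableSet_countEvent h.jumps.measurable t n)

lemma IsPoissonizedScheme.poissonCount_ae_eq (h : IsPoissonizedScheme p P X E) (j : ℕ)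
    {t : ℝ} (ht : 0 ≤ t) :
    ∀ᵐ ω ∂P, poissonCount X E j t ω = ({k | ω ∈ poissonEvent X E j t k}.ncard : ℝ) := by
  filter_upwards [h.jumps.ae_exists_countEvent ht] with ω ⟨n, hn⟩
  have hn' : {i : ℕ | throwTime E i ω ≤ t} = {i : ℕ | i < n} := hn
  rw [poissonCount, hn', ← detCount, detCount_eq_ncard]
  congr 2
  ext k
  change ω ∈ detEvent X j n k ↔ ω ∈ poissonEvent X E j t k
  constructor
  · exact fun hk => Set.mem_iUnion.2 ⟨n, hk, hn⟩
  · intro hk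
    obtain ⟨m, h1, h2⟩ := Set.mem_iUnion.1 hk
    have : m = n := by
      by_contra hmn
      exact Set.disjoint_left.1 (pairwise_disjoint_countEvent E t hmn) h2 hn
    exact this ▸ h1

/-- Conditioning an event of the Poissonized scheme on the number of balls thrown. -/
lemma IsPoissonizedScheme.hasSum_measureReal (h : IsPoissonizedScheme p P X E) {t : ℝ}
    (ht : 0 ≤ t) {B : ℕ → Set (ℕ → ℕ)} (hB : ∀ n, MeasurableSet (B n)) :
    HasSum (fun n => poissonWeight n t * P.real ((fun ω i => X i ω) ⁻¹' B n))
      (P.real (⋃ n, ((fun ω i => X i ω) ⁻¹' B n) ∩ countEvent E t n)) := by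
  have hXm : Measurable fun ω i => X i ω := measurable_pi_lambda _ h.allocation.measurable
  have hm : ∀ n, MeasurableSet (((fun ω i => X i ω) ⁻¹' B n) ∩ countEvent E t n) := fun n =>
    (hXm (hB n)).inter (measurableSet_countEvent h.jumps.measurable t n)
  have hd : Pairwise (Function.onFun Disjoint
      fun n => ((fun ω i => X i ω) ⁻¹' B n) ∩ countEvent E t n) := fun n m hnm =>
    (pairwise_disjoint_countEvent E t hnm).mono Set.inter_subset_right Set.inter_subset_right
  have hprod : ∀ n, P (((fun ω i => X i ω) ⁻¹' B n) ∩ countEvent E t n) =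
      ENNReal.ofReal (poissonWeight n t * P.real ((fun ω i => X i ω) ⁻¹' B n)) := by
    intro n
    -- Both events become preimages under the sequences of boxes and of jumps, so the independence
    -- of these sequences applies.
    have hT : countEvent E t n =
        (fun ω i => E i ω) ⁻¹' (countEvent (fun i (x : ℕ → ℝ) => x i) t n) := rfl
    rw [hT, h.indep.measure_inter_preimage_eq_mul _ _ (hB n)
      (measurableSet_countEvent (fun i => measurable_pi_apply i) t n), ← hT,
      ENNReal.ofReal_mul (poissonWeight_nonneg n ht), ← h.jumps.measureReal_countEvent ht,
      ofReal_measureReal, ofReal_measureReal, mul_comm]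
  have h0 : ∀ n, 0 ≤ poissonWeight n t * P.real ((fun ω i => X i ω) ⁻¹' B n) := fun n =>
    mul_nonneg (poissonWeight_nonneg n ht) measureReal_nonneg
  have hs : Summable fun n => poissonWeight n t * P.real ((fun ω i => X i ω) ⁻¹' B n) :=
    Summable.of_nonneg_of_le h0
      (fun n => mul_le_of_le_one_right (poissonWeight_nonneg n ht) measureReal_le_one)
      (hasSum_poissonWeight t).summable
  have e : P.real (⋃ n, ((fun ω i => X i ω) ⁻¹' B n) ∩ countEvent E t n) =
      ∑' n, poissonWeight n t * P.real ((fun ω i => X i ω) ⁻¹' B n) := by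
    rw [measureReal_def, measure_iUnion hd hm]
    simp_rw [hprod]
    rw [← ENNReal.ofReal_tsum_of_nonneg h0 hs, ENNReal.toReal_ofReal (tsum_nonneg h0)]
  rw [e]
  exact hs.hasSum

/-- The number of balls in a box at time `t` has a Poisson distribution. -/
lemma IsPoissonizedScheme.measureReal_poissonEvent (h : IsPoissonizedScheme p P X E) (j : ℕ)
    {t : ℝ} (ht : 0 ≤ t) (k : ℕ) :
    P.real (poissonEvent X E j t k) = poissonWeight j ((p k).toReal * t) := by
  have h1 := h.hasSum_measureReal ht
    (B := fun n => detEvent (fun i (x : ℕ → ℕ) => x i) j n k)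
    (fun n => measurableSet_detEvent (fun i => measurable_pi_apply i) j n k)
  refine h1.unique ?_
  refine (hasSum_poissonWeight_mul_binomialWeight j t (p k).toReal).congr_fun fun n => ?_
  rw [← h.allocation.measureReal_detEvent j n k]
  rfl

/-- The numbers of balls in different boxes at time `t` are independent. -/
lemma IsPoissonizedScheme.measureReal_poissonEvent_inter (h : IsPoissonizedScheme p P X E)
    (j : ℕ) {t : ℝ} (ht : 0 ≤ t) {k l : ℕ} (hkl : k ≠ l) :
    P.real (poissonEvent X E j t k ∩ poissonEvent X E j t l) =
      poissonWeight j ((p k).toReal * t) * poissonWeight j ((p l).toReal * t) := by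
  have h1 := h.hasSum_measureReal ht
    (B := fun n => detEvent (fun i (x : ℕ → ℕ) => x i) j n k ∩
      detEvent (fun i (x : ℕ → ℕ) => x i) j n l)
    (fun n => (measurableSet_detEvent (fun i => measurable_pi_apply i) j n k).inter
      (measurableSet_detEvent (fun i => measurable_pi_apply i) j n l))
  have e : poissonEvent X E j t k ∩ poissonEvent X E j t l =
      ⋃ n, (detEvent X j n k ∩ detEvent X j n l) ∩ countEvent E t n := by
    ext ω
    simp only [poissonEvent, Set.mem_inter_iff, Set.mem_iUnion]
    constructor
    · rintro ⟨⟨n, h1, h2⟩, m, h3, h4⟩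
      have : m = n := by
        by_contra hmn
        exact Set.disjoint_left.1 (pairwise_disjoint_countEvent E t hmn) h4 h2
      exact ⟨n, ⟨h1, this ▸ h3⟩, h2⟩
    · rintro ⟨n, ⟨h1, h2⟩, h3⟩
      exact ⟨⟨n, h1, h3⟩, n, h2, h3⟩
  rw [e]
  refine h1.unique ?_
  refine (hasSum_poissonWeight_mul_trinomialWeight j t (p k).toReal (p l).toReal).congr_fun
    fun n => ?_
  rw [← h.allocation.measureReal_detEvent_inter j n hkl]
  rfl

end Poissonized

/-! ### Comparison of the variances -/

/-- Turns the Poissonized variance into a sum over pairs, so that the two variances can be compared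
term by term. -/
lemma hasSum_diagonal {f : ℕ → ℝ} {s : ℝ} (h : HasSum f s) :
    HasSum (fun x : ℕ × ℕ => if x.1 = x.2 then f x.1 else 0) s := by
  have hinj : Function.Injective fun k : ℕ => (k, k) := fun k l h => (Prod.mk.inj h).1
  rw [← hinj.hasSum_iff]
  · simpa [Function.comp_def] using h
  · rintro ⟨k, l⟩ hx
    exact if_neg fun hkl => hx ⟨k, Prod.ext rfl hkl⟩

lemma summable_measureReal_inter {Ω : Type*} [MeasurableSpace Ω] {P : Measure Ω}
    [IsFiniteMeasure P] {A : ℕ → Set Ω} {f : ℕ → ℝ} (hf0 : ∀ k, 0 ≤ f k) (hf : Summable f)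
    (h₁ : Summable fun k => P.real (A k))
    (h₂ : ∀ k l, k ≠ l → P.real (A k ∩ A l) ≤ f k * f l) :
    Summable fun x : ℕ × ℕ => P.real (A x.1 ∩ A x.2) := by
  refine Summable.of_nonneg_of_le (fun x => measureReal_nonneg) (fun x => ?_)
    ((hf.mul_of_nonneg hf hf0 hf0).add (hasSum_diagonal h₁.hasSum).summable)
  rcases eq_or_ne x.1 x.2 with h | h
  · rw [if_pos h]
    exact le_add_of_nonneg_of_le (mul_nonneg (hf0 _) (hf0 _))
      (measureReal_mono Set.inter_subset_left)
  · rw [if_neg h, add_zero]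
    exact h₂ _ _ h

section Scheme

variable {p : PMF ℕ} {j : ℕ}

section

variable {Ω : Type*} [MeasurableSpace Ω] {P : Measure Ω} [IsProbabilityMeasure P]
  {X : ℕ → Ω → ℕ} {E : ℕ → Ω → ℝ}

lemma IsAllocation.summable_detEvent (hX : IsAllocation p P X) (hj : 1 ≤ j) (n : ℕ) :
    Summable fun k => P.real (detEvent X j n k) := by
  refine Summable.of_nonneg_of_le (fun k => measureReal_nonneg) (fun k => ?_)
    ((summable_toReal p).mul_left (n.choose j : ℝ))
  have h0 := ENNReal.toReal_nonneg (a := p k)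
  have h1 := toReal_le_one p k
  rw [hX.measureReal_detEvent, binomialWeight, mul_assoc]
  gcongr
  calc (p k).toReal ^ j * (1 - (p k).toReal) ^ (n - j) ≤ (p k).toReal * 1 :=
        mul_le_mul (pow_le_of_le_one h0 h1 (by omega)) (pow_le_one₀ (by linarith) (by linarith))
          (pow_nonneg (by linarith) _) h0
    _ = _ := mul_one _

lemma IsAllocation.summable_detEvent_inter (hX : IsAllocation p P X) (hj : 1 ≤ j) (n : ℕ) :
    Summable fun x : ℕ × ℕ => P.real (detEvent X j n x.1 ∩ detEvent X j n x.2) := by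
  -- c dominates both binomial coefficients, which yields a bound of the product form f k * f l.
  set c : ℝ := n.choose j + (n - j).choose j with hc
  refine summable_measureReal_inter (f := fun k => c * (p k).toReal)
    (fun k => mul_nonneg (by positivity) ENNReal.toReal_nonneg)
    ((summable_toReal p).mul_left c) (hX.summable_detEvent hj n) fun k l hkl => ?_
  have h0 := ENNReal.toReal_nonneg (a := p k)
  have h1 := toReal_le_one p k
  have h0' := ENNReal.toReal_nonneg (a := p l)
  have h1' := toReal_le_one p l
  have h2 := add_toReal_le_one p hkl
  rw [hX.measureReal_detEvent_inter j n hkl, trinomialWeight]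
  calc _ ≤ (c * c) * (p k).toReal * (p l).toReal * 1 := by
        gcongr
        · exact pow_nonneg (by linarith) _
        · exact le_add_of_nonneg_right (by positivity)
        · exact le_add_of_nonneg_left (by positivity)
        · exact pow_le_of_le_one h0 h1 (by omega)
        · exact pow_le_of_le_one h0' h1' (by omega)
        · exact pow_le_one₀ (by linarith) (by linarith)
    _ = _ := by ring

lemma IsAllocation.variance_detCount (hX : IsAllocation p P X) (hj : 1 ≤ j) (n : ℕ) :
    variance (detCount X j n) P = ∑' x : ℕ × ℕ,
      (P.real (detEvent X j n x.1 ∩ detEvent X j n x.2) -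
        P.real (detEvent X j n x.1) * P.real (detEvent X j n x.2)) :=
  variance_ncard_eq_tsum (measurableSet_detEvent hX.measurable j n)
    (Eventually.of_forall fun ω => detCount_eq_ncard X j n ω) (hX.summable_detEvent hj n)
    (hX.summable_detEvent_inter hj n)

lemma summable_poissonWeight (p : PMF ℕ) (hj : 1 ≤ j) {t : ℝ} (ht : 0 ≤ t) :
    Summable fun k => poissonWeight j ((p k).toReal * t) := by
  have h := (summable_momentSum (fun k => ENNReal.toReal_nonneg) (summable_toReal p) hj ht).div_const
    (j.factorial : ℝ)
  refine h.congr fun k => ?_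
  rw [poissonWeight, mul_comm (Real.exp _)]

lemma summable_poissonVariance (p : PMF ℕ) (hj : 1 ≤ j) {t : ℝ} (ht : 0 ≤ t) :
    Summable fun k => poissonWeight j ((p k).toReal * t) -
      poissonWeight j ((p k).toReal * t) ^ 2 := by
  have h0 : ∀ k, 0 ≤ poissonWeight j ((p k).toReal * t) := fun k =>
    poissonWeight_nonneg j (mul_nonneg ENNReal.toReal_nonneg ht)
  refine Summable.of_nonneg_of_le (fun k => ?_) (fun k => ?_) (summable_poissonWeight p hj ht)
  · have := poissonWeight_le_two_thirds hj (mul_nonneg (ENNReal.toReal_nonneg (a := p k)) ht)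
    nlinarith [h0 k]
  · linarith [sq_nonneg (poissonWeight j ((p k).toReal * t))]

/-- In the Poissonized scheme the variance is a single sum, since the boxes are independent. -/
lemma IsPoissonizedScheme.variance_poissonCount (h : IsPoissonizedScheme p P X E) (hj : 1 ≤ j)
    {t : ℝ} (ht : 0 ≤ t) :
    variance (poissonCount X E j t) P = ∑' k, (poissonWeight j ((p k).toReal * t) -
      poissonWeight j ((p k).toReal * t) ^ 2) := by
  have hs := summable_poissonWeight p hj ht
  have h1 : Summable fun k => P.real (poissonEvent X E j t k) :=
    hs.congr fun k => (h.measureReal_poissonEvent j ht k).symm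
  rw [variance_ncard_eq_tsum (h.measurableSet_poissonEvent j t) (h.poissonCount_ae_eq j ht) h1
    (summable_measureReal_inter
      (fun k => poissonWeight_nonneg j (mul_nonneg ENNReal.toReal_nonneg ht)) hs h1
      fun k l hkl => (h.measureReal_poissonEvent_inter j ht hkl).le),
    ← (hasSum_diagonal (summable_poissonVariance p hj ht).hasSum).tsum_eq]
  refine tsum_congr fun x => ?_
  rcases eq_or_ne x.1 x.2 with hx | hx
  · rw [if_pos hx, ← hx, Set.inter_self, h.measureReal_poissonEvent j ht, sq]
  · rw [if_neg hx, h.measureReal_poissonEvent_inter j ht hx, h.measureReal_poissonEvent j ht,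
      h.measureReal_poissonEvent j ht, sub_self]

end

/-- Each Poisson weight q is at most 2/3, so q ≤ 3 (q - q²). -/
lemma momentSum_le_poissonVariance (p : PMF ℕ) (hj : 1 ≤ j) {t : ℝ} (ht : 0 ≤ t) :
    momentSum (fun k => (p k).toReal) j t ≤ 3 * j.factorial *
      ∑' k, (poissonWeight j ((p k).toReal * t) - poissonWeight j ((p k).toReal * t) ^ 2) := by
  rw [momentSum, ← tsum_mul_left]
  refine (summable_momentSum (fun k => ENNReal.toReal_nonneg) (summable_toReal p) hj ht).tsum_le_tsum
    (fun k => ?_) ((summable_poissonVariance p hj ht).mul_left _)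
  have hx : 0 ≤ (p k).toReal * t := mul_nonneg ENNReal.toReal_nonneg ht
  have h0 := poissonWeight_nonneg j hx
  have h1 := poissonWeight_le_two_thirds hj hx
  have e : ((p k).toReal * t) ^ j * Real.exp (-((p k).toReal * t)) =
      j.factorial * poissonWeight j ((p k).toReal * t) := by
    rw [poissonWeight]; field_simp
  rw [e, mul_comm (3 : ℝ), mul_assoc]
  gcongr
  nlinarith

lemma hasSum_majorant (p : PMF ℕ) (hj : 1 ≤ j) {t : ℝ} (ht : 0 ≤ t) :
    HasSum (fun k => majorant j ((p k).toReal * t))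
      (2 ^ j * momentSum (fun k => (p k).toReal) j (t / 2)) := by
  have h := (summable_momentSum (fun k => ENNReal.toReal_nonneg) (summable_toReal p) hj
    (show 0 ≤ t / 2 by positivity)).hasSum.mul_left (2 ^ j)
  refine h.congr_fun fun k => ?_
  rw [majorant, ← mul_div_assoc, ← mul_assoc, ← mul_pow]
  congr 2
  ring

/-- The difference of the two variances, in terms of the sum of the majorants. -/
lemma exists_abs_variance_sub_le (p : PMF ℕ) (hj : 1 ≤ j) {Ω Ω' : Type*} [MeasurableSpace Ω]
    [MeasurableSpace Ω'] {P : Measure Ω} [IsProbabilityMeasure P] {P' : Measure Ω'}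
    [IsProbabilityMeasure P'] {X : ℕ → Ω → ℕ} (hX : IsAllocation p P X) {X' : ℕ → Ω' → ℕ}
    {E : ℕ → Ω' → ℝ} (h : IsPoissonizedScheme p P' X' E) :
    ∃ C : ℝ, 0 ≤ C ∧ ∀ n : ℕ, 2 * j + 1 ≤ n →
      |variance (detCount X j n) P - variance (poissonCount X' E j n) P'| ≤
        C / n * ((∑' k, majorant j ((p k).toReal * n)) * (∑' k, majorant j ((p k).toReal * n)) +
          ∑' k, majorant j ((p k).toReal * n)) := by
  obtain ⟨C₁, hC₁, h₁⟩ := exists_abs_binomialWeight_sub_le j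
  obtain ⟨C₂, hC₂, h₂⟩ := exists_abs_trinomialWeight_sub_le j
  refine ⟨C₁ + C₂, by positivity, fun n hn => ?_⟩
  have hn0 : (0 : ℝ) ≤ n := Nat.cast_nonneg n
  have hw : ∀ k, 0 ≤ (p k).toReal * n := fun k => mul_nonneg ENNReal.toReal_nonneg hn0
  have hu0 : ∀ k, 0 ≤ majorant j ((p k).toReal * n) := fun k => majorant_nonneg j (hw k)
  have hu := (hasSum_majorant p hj hn0).summable
  have hS := (((hu.hasSum.mul hu.hasSum (hu.mul_of_nonneg hu hu0 hu0)).add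
    (hasSum_diagonal hu.hasSum)).mul_left ((C₁ + C₂) / n))
  have hq := hasSum_diagonal (summable_poissonVariance p hj hn0).hasSum
  have hd := hX.summable_detEvent hj n
  rw [h.variance_poissonCount hj hn0, hX.variance_detCount hj, ← hq.tsum_eq,
    ← ((hX.summable_detEvent_inter hj n).sub (hd.mul_of_nonneg hd
      (fun _ => measureReal_nonneg) (fun _ => measureReal_nonneg))).tsum_sub hq.summable,
    ← Real.norm_eq_abs]
  refine tsum_of_norm_bounded hS fun x => ?_
  rw [Real.norm_eq_abs]
  have hC1 : C₁ / n ≤ (C₁ + C₂) / n := by gcongr; linarith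
  have hC2 : C₂ / n ≤ (C₁ + C₂) / n := by gcongr; linarith
  have huu := mul_nonneg (hu0 x.1) (hu0 x.2)
  rcases eq_or_ne x.1 x.2 with hx | hx
  · rw [if_pos hx, if_pos hx, ← hx, Set.inter_self]
    have b0 : 0 ≤ P.real (detEvent X j n x.1) := measureReal_nonneg
    have b1 : P.real (detEvent X j n x.1) ≤ 1 := measureReal_le_one
    rw [hX.measureReal_detEvent] at b0 b1 ⊢
    have q0 := poissonWeight_nonneg j (hw x.1)
    have q1 := poissonWeight_le_two_thirds hj (hw x.1)
    have hb := h₁ n hn (p x.1).toReal ENNReal.toReal_nonneg (toReal_le_one p x.1)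
    set b := binomialWeight j n (p x.1).toReal
    set q := poissonWeight j ((p x.1).toReal * n)
    -- The map y ↦ y - y² is a contraction on [0, 1], so the diagonal error is at most |b - q|.
    rw [show b - b * b - (q - q ^ 2) = (b - q) * (1 - (b + q)) by ring, abs_mul]
    have habs : |1 - (b + q)| ≤ 1 := by rw [abs_le]; constructor <;> linarith
    have huu' := mul_nonneg (hu0 x.1) (hu0 x.1)
    calc |b - q| * |1 - (b + q)| ≤ |b - q| * 1 := by gcongr
      _ ≤ C₁ / n * majorant j ((p x.1).toReal * n) := by rw [mul_one]; exact hb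
      _ ≤ _ := by
        gcongr
        · exact hu0 _
        · exact le_add_of_nonneg_left huu'
  · rw [if_neg hx, if_neg hx, sub_zero, add_zero, hX.measureReal_detEvent_inter j n hx,
      hX.measureReal_detEvent, hX.measureReal_detEvent]
    exact (h₂ n hn _ _ ENNReal.toReal_nonneg ENNReal.toReal_nonneg (add_toReal_le_one p hx)).trans
      (by gcongr)

end Scheme

end Karlin

end

/-! ### The ratio of the variances -/

theorem proposition4p7
    (p : PMF ℕ) (hp : {k : ℕ | 0 < (p k).toReal}.Infinite)
    (hrho : Karlin.DeHaanInfty (Karlin.rho p) ∨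
      ∃ α : ℝ, 0 < α ∧ α ≤ 1 ∧ Karlin.RegularlyVarying α (Karlin.rho p))
    {Ω : Type*} [MeasurableSpace Ω] (P : Measure Ω) [IsProbabilityMeasure P]
    (X : ℕ → Ω → ℕ) (hX : Karlin.IsAllocation p P X)
    {Ω' : Type*} [MeasurableSpace Ω'] (P' : Measure Ω') [IsProbabilityMeasure P']
    (X' : ℕ → Ω' → ℕ) (E : ℕ → Ω' → ℝ) (hXE : Karlin.IsPoissonizedScheme p P' X' E)
    (j : ℕ) (hj : 1 ≤ j) :
    Tendsto
      (fun n : ℕ => variance (Karlin.detCount X j n) P /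
        variance (Karlin.poissonCount X' E j (n : ℝ)) P')
      atTop (𝓝 1) := by
  open Karlin in
  have hw0 : ∀ k, 0 ≤ (p k).toReal := fun k => ENNReal.toReal_nonneg
  have hw := summable_toReal p
  set F : ℝ → ℝ := momentSum (fun k => (p k).toReal) j with hF
  obtain ⟨K, hK, hdouble⟩ : ∃ K : ℝ, 0 ≤ K ∧ ∀ᶠ t in atTop, F (t / 2) ≤ K * F t := by
    refine exists_momentSum_half_le hw0 hw hj ?_
    rcases hrho with h | ⟨α, hα, -, h⟩
    · exact exists_tailSum_le_of_deHaanInfty p h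
    · exact exists_tailSum_le_of_regularlyVarying p hα h
  obtain ⟨C, hC, hdiff⟩ := exists_abs_variance_sub_le p hj hX hXE
  -- A single box of positive probability makes F positive, hence also the Poissonized variance in
  -- the denominator.
  obtain ⟨k₀, hk₀⟩ := hp.nonempty
  have hlim : Tendsto (fun n : ℕ => (3 * j.factorial * C * 2 ^ j * K) *
      (2 ^ j / 2 * (F ((n : ℝ) / 2) / ((n : ℝ) / 2)) + 1 / (n : ℝ))) atTop (𝓝 0) := by
    have h1 : Tendsto (fun n : ℕ => (n : ℝ) / 2) atTop atTop :=
      tendsto_natCast_atTop_atTop.atTop_div_const two_pos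
    have h2 := ((tendsto_momentSum_div hw0 hw hj).comp h1).const_mul (2 ^ j / 2 : ℝ)
    have h3 := (h2.add tendsto_one_div_atTop_nhds_zero_nat).const_mul
      (3 * j.factorial * C * 2 ^ j * K)
    simpa using h3
  rw [tendsto_iff_norm_sub_tendsto_zero]
  refine squeeze_zero' (Eventually.of_forall fun n => norm_nonneg _) ?_ hlim
  filter_upwards [tendsto_natCast_atTop_atTop.eventually hdouble, eventually_ge_atTop (2 * j + 1)]
    with n hd hn
  have hn0 : (0 : ℝ) < n := by exact_mod_cast (by omega : 0 < n)
  have hFpos : 0 < F n := momentSum_pos hw0 hw hj hn0 hk₀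
  have hF2 : 0 < F ((n : ℝ) / 2) := momentSum_pos hw0 hw hj (by positivity) hk₀
  have hV := momentSum_le_poissonVariance p hj hn0.le
  rw [← hXE.variance_poissonCount hj hn0.le] at hV
  have hdn := hdiff n hn
  rw [(hasSum_majorant p hj hn0.le).tsum_eq] at hdn
  change F n ≤ _ at hV
  change _ ≤ C / n * (2 ^ j * F ((n : ℝ) / 2) * (2 ^ j * F ((n : ℝ) / 2)) +
    2 ^ j * F ((n : ℝ) / 2)) at hdn
  set V := variance (poissonCount X' E j (n : ℝ)) P' with hVdef
  have hVpos : 0 < V := by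
    by_contra hneg
    have : 3 * (j.factorial : ℝ) * V ≤ 0 :=
      mul_nonpos_of_nonneg_of_nonpos (by positivity) (not_lt.1 hneg)
    linarith
  rw [Real.norm_eq_abs, div_sub_one hVpos.ne', abs_div, abs_of_pos hVpos, div_le_iff₀ hVpos]
  set G := F ((n : ℝ) / 2) with hG
  have hGV : G ≤ K * (3 * j.factorial * V) := hd.trans (by gcongr)
  calc _ ≤ _ := hdn
    -- One factor G is exchanged for the variance V by the doubling bound; the other stays with 1 /
    -- n and produces the null sequence of `hlim`.
    _ = C / n * (2 ^ j * G + 1) * 2 ^ j * G := by ring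
    _ ≤ C / n * (2 ^ j * G + 1) * 2 ^ j * (K * (3 * j.factorial * V)) := by gcongr
    _ = _ := by field_simp
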